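/- Let $d\ge 2$ and $k\ge 2$ be integers and $\tfrac12<\alpha<k-1$. For $n\ge 1$ put $R_n=\frac{2}{d-1}\log n$, $\omega_n=\log\log R_n$. (For the finitely many $n$ with $R_n\le 1$, where this is undefined, let $\omega_n$ be fixed real numbers, e.g. $\log|\log R_n|$ if $0<R_n<1$, and $0$ if $R_n=0$.) Put $\kappa_{d-2}=\int_0^\pi\sin^{d-2}\theta\,d\theta$, $$B_\alpha=\frac{2^d\alpha}{(d-1)(2\alpha-1)\kappa_{d-2}},\qquad B_{k,\alpha}=B_\alpha^{k-1}.$$ Let $\mathcal B_d$ be the Poincaré ball, that is, the open unit ball of $\mathbb R^d$ with the Riemannian metric $4|dx|^2/(1-|x|^2)^2$, let $d_H$ be its Riemannian distance and $o$ its origin. Write $(t,\boldsymbol\theta)$, with $0\le t\le R_n$ and $\boldsymbol\theta\in\mathcal A_d=[0,\pi]^{d-2}\times[0,2\pi)$, for the point at hyperbolic distance $R_n-t$ from $o$ in the direction with spherical coordinates $\boldsymbol\theta$. Let $\mathcal P_n=\{X_1,\dots,X_{N_n}\}$, where $N_n$ is Poisson with mean $n$ and, independently of $N_n$, the points $X_1,X_2,\dots$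 are i.i.d., each with coordinates $(t,\boldsymbol\theta)$ of joint density $$\frac{\sinh^{d-1}(\alpha(R_n-t))}{\int_0^{R_n}\sinh^{d-1}(\alpha x)\,dx}\cdot\frac{\prod_{i=1}^{d-2}\sin^{d-i-1}\theta_i}{2\prod_{i=1}^{d-1}\int_0^\pi\sin^{d-i-1}\theta\,d\theta}$$ on $[0,R_n]\times\mathcal A_d$ (for $n\ge 2$; nothing is claimed for $n=1$, where $R_1=0$). For $p=(u,\boldsymbol\theta)$ let $\mathcal D_{k,n}(u,\boldsymbol\theta)$ be the number of $(k-1)$-tuples $(Y_1,\dots,Y_{k-1})$ of pairwise distinct points of $\mathcal P_n$ with $d_H(Y_i,p)\le R_n$ for all $i$, and let $\mu_{k,n}(u)=\mathbb E[\mathcal D_{k,n}(u,\boldsymbol\theta)]$. The following bounds hold for every $\boldsymbol\theta\in\mathcal A_d$ (and uniformly in $\boldsymbol\theta$; in fact $\mu_{k,n}(u)$ does not depend on $\boldsymbol\theta$), and these expectations are finite for $u\in(0,R_n)$. Let $\gamma\in(\frac1{2\alpha},1)$ and $s_n=B_\alpha^{-1}n^{-(2\alpha-1)(1-\gamma)}e^{\alpha(d-1)\omega_n}$.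 (i) As $n\to\infty$, uniformly for $u\in(0,\gamma R_n)$, $$\mu_{k,n}(u)\le(1+o(1))\,B_{k,\alpha}\Big(1+\sum_{\ell=0}^{k-2}\binom{k-1}{\ell}\big(e^{\frac12(d-1)(1-2\alpha)u}+s_n\big)^{k-1-\ell}\Big)e^{\frac12(d-1)(k-1)u}.$$ (ii) As $n\to\infty$, uniformly for $u\in(0,\gamma R_n)$, $$\mu_{k,n}(u)\ge(1+o(1))\,B_{k,\alpha}\big(1-e^{\frac12(d-1)(1-2\alpha)u}\big)^{k-1}e^{\frac12(d-1)(k-1)u}.$$ (iii) There is $C\in(0,\infty)$, independent of $n$, $u$ and $\gamma$, such that for all $n\ge1$ and $u\in(0,R_n)$, $$\mu_{k,n}(u)\le C\,e^{\alpha(d-1)(k-1)\omega_n}\,e^{\frac12(d-1)(k-1)u}.$$ -/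

import Mathlib

open MeasureTheory Filter Topology

noncomputable section

namespace HypStar

/-- The ambient space `ℝ^d` of the Poincaré ball `{x : ‖x‖ < 1}`. -/
abbrev E (d : ℕ) : Type := EuclideanSpace ℝ (Fin d)

/-- The length of the curve `c : [0,1] → ball` for the Riemannian metric
`ds² = 4 |dx|² / (1 - |x|²)²`. -/
def hypLength {d : ℕ} (c : ℝ → E d) : ℝ :=
  ∫ t in (0 : ℝ)..1, 2 * ‖deriv c t‖ / (1 - ‖c t‖ ^ 2)

/-- The hyperbolic distance on the Poincaré ball: the infimum of the Riemannian lengths of the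
`C¹` curves in the ball from `x` to `y`. -/
def hypDist {d : ℕ} (x y : E d) : ℝ :=
  sInf {L : ℝ | ∃ c : ℝ → E d, ContDiff ℝ 1 c ∧ (∀ t ∈ Set.Icc (0 : ℝ) 1, ‖c t‖ < 1) ∧
    c 0 = x ∧ c 1 = y ∧ L = hypLength c}

/-- The radius `R_n = (2 / (d - 1)) log n`. -/
def R (d n : ℕ) : ℝ := 2 / ((d : ℝ) - 1) * Real.log n

/-- `ω_n = log log R_n`. (For the finitely many `n` with `R_n ≤ 1`, where the iterated logarithm
makes no sense, this is just some real number.) -/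
def omega (d n : ℕ) : ℝ := Real.log (Real.log (R d n))

/-- `κ_{d-2} = ∫_0^π sin^{d-2} θ dθ`. -/
def kappa (d : ℕ) : ℝ := ∫ x in (0 : ℝ)..Real.pi, Real.sin x ^ (d - 2)

/-- `B_α = 2^d α / ((d - 1) (2α - 1) κ_{d-2})`. -/
def B (d : ℕ) (α : ℝ) : ℝ := 2 ^ d * α / (((d : ℝ) - 1) * (2 * α - 1) * kappa d)

/-- `B_{k,α} = B_α^{k-1}`. -/
def Bk (d k : ℕ) (α : ℝ) : ℝ := B d α ^ (k - 1)

/-- `s_n = B_α⁻¹ n^{-(2α-1)(1-γ)} e^{α (d-1) ω_n}`. -/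
def s (d : ℕ) (α γ : ℝ) (n : ℕ) : ℝ :=
  (B d α)⁻¹ * (n : ℝ) ^ (-((2 * α - 1) * (1 - γ))) * Real.exp (α * ((d : ℝ) - 1) * omega d n)

/-- The density of the radial component, measured from the boundary of the ball:
`sinh^{d-1}(α (R_n - t)) / ∫_0^{R_n} sinh^{d-1}(α x) dx`, for `0 ≤ t ≤ R_n`. -/
def radialDensity (d n : ℕ) (α t : ℝ) : ℝ :=
  Real.sinh (α * (R d n - t)) ^ (d - 1) /
    ∫ x in (0 : ℝ)..(R d n), Real.sinh (α * x) ^ (d - 1)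

/-- The law of the radial component. -/
def radialLaw (d n : ℕ) (α : ℝ) : Measure ℝ :=
  (volume.restrict (Set.Icc 0 (R d n))).withDensity fun t => ENNReal.ofReal (radialDensity d n α t)

/-- The set `[0,π]^{d-2} × [0,2π)` of angles; the coordinate `θ_{i+1}` is `θ i`. -/
def angles (d : ℕ) : Set (Fin (d - 1) → ℝ) :=
  {θ | ∀ i, 0 ≤ θ i ∧ (if i.val + 1 < d - 1 then θ i ≤ Real.pi else θ i < 2 * Real.pi)}

/-- The uniform angular density
`∏_{i=1}^{d-2} sin^{d-i-1} θ_i / (2 ∏_{i=1}^{d-1} ∫_0^π sin^{d-i-1} x dx)`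
(the factor for `i = d - 1` in the numerator is a zeroth power). -/
def angularDensity (d : ℕ) (θ : Fin (d - 1) → ℝ) : ℝ :=
  (∏ i : Fin (d - 1), Real.sin (θ i) ^ (d - 2 - i.val)) /
    (2 * ∏ i : Fin (d - 1), ∫ x in (0 : ℝ)..Real.pi, Real.sin x ^ (d - 2 - i.val))

/-- The law of the angular component. -/
def angularLaw (d : ℕ) : Measure (Fin (d - 1) → ℝ) :=
  (volume.restrict (angles d)).withDensity fun θ => ENNReal.ofReal (angularDensity d θ)

/-- The unit vector with spherical coordinates `θ`:
`(cos θ₁, sin θ₁ cos θ₂, …, sin θ₁ ⋯ sin θ_{d-2} cos θ_{d-1}, sin θ₁ ⋯ sin θ_{d-1})`. -/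
def direction (d : ℕ) (θ : Fin (d - 1) → ℝ) : E d :=
  WithLp.toLp 2 fun j =>
    (∏ i : Fin (d - 1), if i.val < j.val then Real.sin (θ i) else 1) *
      (if h : j.val < d - 1 then Real.cos (θ ⟨j.val, h⟩) else 1)

/-- The point `(t, θ)` of the hyperbolic ball `B(o, R_n)`: it lies in direction `θ` from the
origin at hyperbolic distance `R_n - t`, i.e. at Euclidean distance `tanh ((R_n - t) / 2)`. -/
def point (d n : ℕ) (t : ℝ) (θ : Fin (d - 1) → ℝ) : E d :=
  Real.tanh ((R d n - t) / 2) • direction d θ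

/-- The law of a vertex: the point whose depth and angle have joint law
`radialDensity ⊗ angularDensity`. -/
def vertexLaw (d n : ℕ) (α : ℝ) : Measure (E d) :=
  ((radialLaw d n α).prod (angularLaw d)).map fun x => point d n x.1 x.2

/-- The law of the finite random sequence `(X_1, …, X_N)` where `N` is Poisson with mean `n` and
the `X_i` are i.i.d. with law `vertexLaw`, independent of `N`: with probability
`e^{-n} n^m / m!` the length is `m`, and given this the law is the `m`-fold product law. The
Poisson process `𝒫_n` is the set of the points of this sequence. -/
def vertexSample (d n : ℕ) (α : ℝ) : Measure (Σ m : ℕ, Fin m → E d) :=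
  Measure.sum fun m : ℕ => ProbabilityTheory.poissonMeasure (n : NNReal) {m} •
    (Measure.pi fun _ : Fin m => vertexLaw d n α).map (Sigma.mk m)

/-- The star count at `p` in a vertex set `P`: the number of `(k-1)`-tuples of distinct points of
`P`, all of them at hyperbolic distance at most `R_n` from `p`. -/
def starCount (d k n : ℕ) (P : Set (E d)) (p : E d) : ℕ :=
  Set.ncard {Y : Fin (k - 1) → E d |
    (∀ i, Y i ∈ P) ∧ Function.Injective Y ∧ ∀ i, hypDist (Y i) p ≤ R d n}

/-- `𝒟_{k,n}(u, θ)`, as a function of the sequence `(X_1, …, X_N)`. -/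
def D (d k n : ℕ) (u : ℝ) (θ : Fin (d - 1) → ℝ) (x : Σ m : ℕ, Fin m → E d) : ℝ :=
  starCount d k n (Set.range x.2) (point d n u θ)

/-- `μ_{k,n}(u) = 𝔼[𝒟_{k,n}(u, θ)]`; its value does not depend on `θ`. -/
def mu (d k n : ℕ) (α u : ℝ) (θ : Fin (d - 1) → ℝ) : ℝ :=
  ∫ x, D d k n u θ x ∂(vertexSample d n α)

end HypStar

end

/-!
The proof shows more than is asked for: the expected star count is the `(k-1)`-st power of the
expected number `λ_n(u)` of vertices within distance `R_n` of a point of depth `u`, and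
`λ_n(u) = (1 + o(1)) B_α e^{(d-1)u/2}` uniformly for `u ∈ (0, γ R_n)`, while
`λ_n(u) ≤ C e^{(d-1)u/2}` for all `u ∈ (0, R_n)` and large `n`. Then (i) and (ii) hold because
their correction factors are at least `1` and at most `1` respectively, and (iii) holds because
`ω_n ≥ 0` for large `n`, the remaining `n` being covered by `λ_n(u) ≤ n`.

* The reduction to `λ_n(u)` is the formula for the factorial moments of a Poisson variable
  (`integrable_D_and_mu_eq`): the vertex law has no atoms, so the vertices are a.s. distinct and
  tuples of distinct vertices are injective tuples of indices.
* The distance `d_H`, an infimum of lengths of curves, is computed in `hypDist_eq_arcosh`. The lower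
  bound holds because the hyperbolic gradient of `cosh d_H(x, ·)` has norm `sinh d_H(x, ·)`; the
  upper bound comes from explicit geodesics in the hyperboloid model. By the hyperbolic law of
  cosines (`coshDist_polar`), points of depths `t` and `u` are within distance `R_n` if and only if
  the cosine of the angle between them is at least `threshold R_n t u`.
* The angular law of a spherical cap does not depend on its centre (`angularLaw_cap`), since
  Lebesgue measure is rotation invariant and is a product measure in spherical coordinates
  (`lintegral_spherical`, by induction on the dimension from polar coordinates of the plane).
* Hence `e^{-(d-1)u/2} λ_n(u)` is a quotient of two integrals over the depth `t`
  (`mul_connProb`). A cap of height `z` has measure of order `z^{(d-1)/2}`, and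
  `1 - threshold R_n t u` is asymptotic to `2 e^{-(R_n - t - u)}`. So the integrand has a limit for
  each fixed `t`, and it is at most a constant times `e^{-(d-1)(α-1/2)t}`, for all `u`. Dominated
  convergence along the filter `bulk γ` of pairs `(ρ, u)` with `ρ → ∞` and `0 < u < γ ρ` gives the
  limit `B_α`, uniformly in `u` (`tendsto_scaledDegree`).
-/

namespace HypStar

/-! ### The hyperbolic distance of the Poincaré ball -/

/-- The hyperbolic cosine of the hyperbolic distance between two points of the Poincaré ball. -/
noncomputable def coshDist {d : ℕ} (x y : E d) : ℝ :=
  1 + 2 * ‖x - y‖ ^ 2 / ((1 - ‖x‖ ^ 2) * (1 - ‖y‖ ^ 2))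

lemma one_sub_norm_sq_pos {d : ℕ} {x : E d} (hx : ‖x‖ < 1) : 0 < 1 - ‖x‖ ^ 2 := by
  nlinarith [norm_nonneg x]

lemma one_le_coshDist {d : ℕ} {x y : E d} (hx : ‖x‖ < 1) (hy : ‖y‖ < 1) :
    1 ≤ coshDist x y := by
  have h1 := one_sub_norm_sq_pos hx
  have h2 := one_sub_norm_sq_pos hy
  have : 0 ≤ 2 * ‖x - y‖ ^ 2 / ((1 - ‖x‖ ^ 2) * (1 - ‖y‖ ^ 2)) := by positivity
  unfold coshDist; linarith

lemma norm_smul_add_smul_sq {V : Type*} [NormedAddCommGroup V] [InnerProductSpace ℝ V]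
    (p q : ℝ) (v w : V) :
    ‖p • v + q • w‖ ^ 2 = p ^ 2 * ‖v‖ ^ 2 + 2 * (p * q * inner ℝ v w) + q ^ 2 * ‖w‖ ^ 2 := by
  rw [norm_add_sq_real, norm_smul, norm_smul, mul_pow, mul_pow, real_inner_smul_left,
    real_inner_smul_right, Real.norm_eq_abs, Real.norm_eq_abs, sq_abs, sq_abs]
  ring

/-- The function `cosh d_H(x, ·)` satisfies `|∇ cosh d_H| = sinh d_H` for the hyperbolic metric;
here as a bound for its derivative along a curve. -/
lemma hasDerivAt_coshDist {d : ℕ} {x : E d} (hx : ‖x‖ < 1) {c : ℝ → E d} {c' : E d} {t : ℝ}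
    (hc : HasDerivAt c c' t) (ht : ‖c t‖ < 1) :
    ∃ F', HasDerivAt (fun s => coshDist x (c s)) F' t ∧
      F' ≤ √(coshDist x (c t) ^ 2 - 1) * (2 * ‖c'‖ / (1 - ‖c t‖ ^ 2)) := by
  have ha := one_sub_norm_sq_pos hx
  have hb := one_sub_norm_sq_pos ht
  set a := 1 - ‖x‖ ^ 2 with ha_def
  have h1 : HasDerivAt (fun s => ‖x - c s‖ ^ 2) (2 * inner ℝ (x - c t) (-c')) t := by
    have := (hc.const_sub x).norm_sq
    simpa using this
  have h2 : HasDerivAt (fun s => 1 - ‖c s‖ ^ 2) (-(2 * inner ℝ (c t) c')) t := by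
    simpa using hc.norm_sq.const_sub 1
  have h3 := ((h1.const_mul 2).div (h2.const_mul a) (by positivity)).const_add 1
  refine ⟨_, h3, ?_⟩
  set b := 1 - ‖c t‖ ^ 2 with hb_def
  set q := ‖x - c t‖ ^ 2 with hq_def
  have hq : 0 ≤ q := by positivity
  have hF : coshDist x (c t) = 1 + 2 * q / (a * b) := rfl
  -- the vector whose pairing with `c'` is the derivative of the numerator
  set w : E d := b • (c t - x) + q • c t with hw
  have hcx : inner ℝ (c t - x) (c t) = (q + a - b) / 2 := by
    have e1 : q = ‖x‖ ^ 2 - 2 * inner ℝ x (c t) + ‖c t‖ ^ 2 := by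
      rw [hq_def, norm_sub_sq_real]
    rw [inner_sub_left, real_inner_self_eq_norm_sq, e1]
    linarith
  have hwn : ‖w‖ ^ 2 = q * (q + a * b) := by
    have : ‖c t‖ ^ 2 = 1 - b := by rw [hb_def]; ring
    rw [hw, norm_smul_add_smul_sq, hcx, norm_sub_rev, ← hq_def, this]
    ring
  have hsq : coshDist x (c t) ^ 2 - 1 = (2 * ‖w‖ / (a * b)) ^ 2 := by
    rw [hF, div_pow, mul_pow, hwn]
    field_simp
    ring
  rw [hsq, Real.sqrt_sq (by positivity)]
  have hin : inner ℝ w c' ≤ ‖w‖ * ‖c'‖ := real_inner_le_norm w c'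
  have hwc : inner ℝ w c' = b * inner ℝ (c t - x) c' + q * inner ℝ (c t) c' := by
    rw [hw, inner_add_left, inner_smul_left, inner_smul_left]; rfl
  have key : (2 * (2 * inner ℝ (x - c t) (-c')) * (a * b) -
      2 * q * (a * -(2 * inner ℝ (c t) c'))) / (a * b) ^ 2 = 4 / (a * b ^ 2) * inner ℝ w c' := by
    rw [hwc, inner_neg_right, ← inner_neg_left, neg_sub]
    field_simp
    ring
  rw [key]
  calc 4 / (a * b ^ 2) * inner ℝ w c' ≤ 4 / (a * b ^ 2) * (‖w‖ * ‖c'‖) := by gcongr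
    _ = _ := by field_simp; ring

/-- No curve is shorter than `arcosh (coshDist x y)`. Since `arcosh` is not differentiable at `1`,
the comparison is made with `log (F + √(F² - 1 + ε))`, and `ε → 0`. -/
lemma arcosh_coshDist_le_hypLength {d : ℕ} {c : ℝ → E d} (hc : ContDiff ℝ 1 c)
    (hb : ∀ t ∈ Set.Icc (0 : ℝ) 1, ‖c t‖ < 1) :
    Real.arcosh (coshDist (c 0) (c 1)) ≤ hypLength c := by
  refine le_of_forall_pos_le_add fun δ hδ => ?_
  have h0 : ‖c 0‖ < 1 := hb 0 (by simp)
  have hder : ∀ t, HasDerivAt c (deriv c t) t := fun t =>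
    (hc.differentiable (by norm_num) t).hasDerivAt
  have hF1 : ∀ t ∈ Set.Icc (0 : ℝ) 1, 1 ≤ coshDist (c 0) (c t) := fun t ht =>
    one_le_coshDist h0 (hb t ht)
  set G : ℝ → ℝ := fun t =>
    Real.log (coshDist (c 0) (c t) + √(coshDist (c 0) (c t) ^ 2 - 1 + δ ^ 2)) with hG
  have hGder : ∀ t ∈ Set.Icc (0 : ℝ) 1, ∃ g', HasDerivAt G g' t ∧
      g' ≤ 2 * ‖deriv c t‖ / (1 - ‖c t‖ ^ 2) := by
    intro t ht
    obtain ⟨F', hF', hle⟩ := hasDerivAt_coshDist h0 (hder t) (hb t ht)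
    have h1 := hF1 t ht
    set F := coshDist (c 0) (c t) with hFdef
    have hpos : 0 < F ^ 2 - 1 + δ ^ 2 := by nlinarith [sq_pos_of_pos hδ]
    have hs := Real.sqrt_pos.2 hpos
    have hd1 := (((hF'.pow 2).sub_const 1).add_const (δ ^ 2)).sqrt hpos.ne'
    have hd2 := (hF'.add hd1).log (ne_of_gt (add_pos (by linarith : (0:ℝ) < F) hs))
    refine ⟨F' / √(F ^ 2 - 1 + δ ^ 2), ?_, ?_⟩
    · refine hd2.congr_deriv ?_
      simp only [Pi.pow_apply, Pi.add_apply]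
      simp only [← hFdef]
      have hss : √(F ^ 2 - 1 + δ ^ 2) * √(F ^ 2 - 1 + δ ^ 2) = F ^ 2 - 1 + δ ^ 2 :=
        Real.mul_self_sqrt hpos.le
      have : F + √(F ^ 2 - 1 + δ ^ 2) ≠ 0 := by positivity
      field_simp
      simp
      ring
    · rw [div_le_iff₀ hs]
      refine hle.trans ?_
      rw [mul_comm]
      have := one_sub_norm_sq_pos (hb t ht)
      gcongr
      nlinarith [sq_pos_of_pos hδ]
  choose! g' hg' hg'le using hGder
  have hint : IntegrableOn (fun t => 2 * ‖deriv c t‖ / (1 - ‖c t‖ ^ 2)) (Set.Icc 0 1) := by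
    refine ContinuousOn.integrableOn_Icc ?_
    have := hc.continuous_deriv le_rfl
    have h2 := hc.continuous
    refine ContinuousOn.div (by fun_prop) (by fun_prop) fun t ht => ?_
    exact (one_sub_norm_sq_pos (hb t ht)).ne'
  have hmain := intervalIntegral.sub_le_integral_of_hasDeriv_right_of_le (g := G) (g' := g')
    (zero_le_one (α := ℝ)) (fun t ht => (hg' t ht).continuousAt.continuousWithinAt)
    (fun t ht => (hg' t ⟨ht.1.le, ht.2.le⟩).hasDerivWithinAt) hint
    (fun t ht => hg'le t ⟨ht.1.le, ht.2.le⟩)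
  have hG0 : G 0 ≤ δ := by
    have : coshDist (c 0) (c 0) = 1 := by simp [coshDist]
    simp only [hG, this]
    rw [one_pow, sub_self, zero_add, Real.sqrt_sq hδ.le]
    have := Real.log_le_sub_one_of_pos (by linarith : 0 < 1 + δ)
    linarith
  have hG1 : Real.arcosh (coshDist (c 0) (c 1)) ≤ G 1 := by
    have := hF1 1 (by simp)
    simp only [hG, Real.arcosh]
    refine Real.log_le_log (by positivity) ?_
    gcongr
    nlinarith [sq_pos_of_pos hδ]
  unfold hypLength
  linarith

/-- The geodesic between two points of the ball, obtained from the hyperboloid model: the point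
`(P₀, P)` of the hyperboloid `P₀² - ‖P‖² = 1`, `P₀ > 0`, corresponds to `P / (1 + P₀)`. -/
lemma exists_geodesic {d : ℕ} {x y : E d} (hx : ‖x‖ < 1) (hy : ‖y‖ < 1) :
    ∃ c : ℝ → E d, ContDiff ℝ 1 c ∧ (∀ t ∈ Set.Icc (0 : ℝ) 1, ‖c t‖ < 1) ∧
      c 0 = x ∧ c 1 = y ∧ Real.arcosh (coshDist x y) = hypLength c := by
  rcases eq_or_ne x y with rfl | hxy
  · refine ⟨fun _ => x, contDiff_const, fun _ _ => hx, rfl, rfl, ?_⟩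
    have : coshDist x x = 1 := by simp [coshDist]
    simp [this, hypLength]
  have ha := one_sub_norm_sq_pos hx
  have hb := one_sub_norm_sq_pos hy
  have hq : 0 < ‖x - y‖ := norm_pos_iff.2 (sub_ne_zero.2 hxy)
  set F := coshDist x y with hF
  have hF1 : 1 < F := by
    have : 0 < 2 * ‖x - y‖ ^ 2 / ((1 - ‖x‖ ^ 2) * (1 - ‖y‖ ^ 2)) := by positivity
    rw [hF]; unfold coshDist; linarith
  set L := Real.arcosh F with hL
  have hcosh : Real.cosh L = F := Real.cosh_arcosh hF1.le
  have hLpos : 0 < L := Real.arcosh_pos hF1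
  set S := Real.sinh L with hS
  have hSpos : 0 < S := Real.sinh_pos_iff.2 hLpos
  have hSF : S ^ 2 = F ^ 2 - 1 := by rw [hS, Real.sinh_sq, hcosh]
  -- the lifts of `x` and `y` to the hyperboloid
  set a := 1 - ‖x‖ ^ 2 with ha_def
  set b := 1 - ‖y‖ ^ 2 with hb_def
  set X0 : ℝ := (2 - a) / a with hX0
  set Y0 : ℝ := (2 - b) / b with hY0
  set X : E d := (2 / a) • x with hX
  set Y : E d := (2 / b) • y with hY
  have hXX : ‖X‖ ^ 2 = X0 ^ 2 - 1 := by
    have : ‖x‖ ^ 2 = 1 - a := by rw [ha_def]; ring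
    rw [hX, norm_smul, mul_pow, this, Real.norm_eq_abs, sq_abs, hX0]
    field_simp; ring
  have hYY : ‖Y‖ ^ 2 = Y0 ^ 2 - 1 := by
    have : ‖y‖ ^ 2 = 1 - b := by rw [hb_def]; ring
    rw [hY, norm_smul, mul_pow, this, Real.norm_eq_abs, sq_abs, hY0]
    field_simp; ring
  have hXY : inner ℝ X Y = X0 * Y0 - F := by
    have h1 : inner ℝ x y = (1 - a + (1 - b) - ‖x - y‖ ^ 2) / 2 := by
      rw [norm_sub_sq_real, ha_def, hb_def]; ring
    rw [hX, hY, inner_smul_left, inner_smul_right, h1, hF, coshDist, ← ha_def, ← hb_def, hX0, hY0]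
    simp only [RCLike.conj_to_real]
    field_simp; ring
  have hX0pos : 1 ≤ X0 := by
    rw [hX0, le_div_iff₀ ha]; nlinarith [norm_nonneg x]
  clear_value X Y X0 Y0
  -- the unit tangent vector at the lift of `x`, pointing to the lift of `y`
  set V0 : ℝ := (Y0 - F * X0) / S with hV0
  set V : E d := (1 / S) • (Y - F • X) with hV
  have hVV : ‖V‖ ^ 2 = V0 ^ 2 + 1 := by
    have : V = (1 / S) • Y + (-F / S) • X := by
      rw [hV, smul_sub, smul_smul, sub_eq_add_neg, ← neg_smul]; congr 2; ring
    rw [this, norm_smul_add_smul_sq, hXX, hYY, real_inner_comm, hXY, hV0]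
    field_simp
    rw [hSF]; ring
  have hXV : inner ℝ X V = X0 * V0 := by
    rw [hV, inner_smul_right, inner_sub_right, inner_smul_right, real_inner_self_eq_norm_sq, hXX,
      hXY, hV0]
    field_simp; ring
  have hV0X0 : V0 ^ 2 ≤ X0 ^ 2 - 1 := by
    have h1 : (inner ℝ X V) ^ 2 ≤ (‖X‖ * ‖V‖) ^ 2 :=
      sq_le_sq' (by linarith [neg_le_of_abs_le (abs_real_inner_le_norm X V)])
        (real_inner_le_norm X V)
    rw [hXV, mul_pow, mul_pow, hXX, hVV] at h1
    nlinarith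
  clear_value V V0
  set P0 : ℝ → ℝ := fun t => Real.cosh (t * L) * X0 + Real.sinh (t * L) * V0 with hP0
  set P : ℝ → E d := fun t => Real.cosh (t * L) • X + Real.sinh (t * L) • V with hP
  set P0' : ℝ → ℝ := fun t => Real.sinh (t * L) * L * X0 + Real.cosh (t * L) * L * V0 with hP0'
  set P' : ℝ → E d := fun t => (Real.sinh (t * L) * L) • X + (Real.cosh (t * L) * L) • V with hP'
  have hP0pos : ∀ t, 0 < 1 + P0 t := by
    intro t
    have h1 : |Real.sinh (t * L)| ≤ Real.cosh (t * L) :=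
      abs_le_of_sq_le_sq (by rw [Real.cosh_sq]; linarith) (Real.cosh_pos _).le
    have h2 : |V0| ≤ X0 := abs_le_of_sq_le_sq (by linarith) (by linarith)
    have h3 : |Real.sinh (t * L) * V0| ≤ Real.cosh (t * L) * X0 := by
      rw [abs_mul]; gcongr
    have := neg_le_of_abs_le h3
    simp only [hP0]; linarith
  have hcs : ∀ t, Real.cosh (t * L) ^ 2 = Real.sinh (t * L) ^ 2 + 1 := fun t => Real.cosh_sq _
  have hPP : ∀ t, ‖P t‖ ^ 2 = P0 t ^ 2 - 1 := by
    intro t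
    simp only [hP, hP0]
    rw [norm_smul_add_smul_sq, hXX, hVV, hXV]
    linear_combination (-1 : ℝ) * hcs t
  have hPP' : ∀ t, inner ℝ (P t) (P' t) = P0 t * P0' t := by
    intro t
    simp only [hP, hP0, hP', hP0', inner_add_left, inner_add_right, inner_smul_left,
      inner_smul_right, real_inner_self_eq_norm_sq, hXX, hVV, real_inner_comm X V, hXV,
      RCLike.conj_to_real]
    ring
  have hPn' : ∀ t, ‖P' t‖ ^ 2 = P0' t ^ 2 + L ^ 2 := by
    intro t
    simp only [hP', hP0']
    rw [norm_smul_add_smul_sq, hXX, hVV, hXV]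
    linear_combination L ^ 2 * hcs t
  have hcd : ∀ t, HasDerivAt (fun s => Real.cosh (s * L)) (Real.sinh (t * L) * L) t := fun t => by
    simpa using ((hasDerivAt_id t).mul_const L).cosh
  have hsd : ∀ t, HasDerivAt (fun s => Real.sinh (s * L)) (Real.cosh (t * L) * L) t := fun t => by
    simpa using ((hasDerivAt_id t).mul_const L).sinh
  have hP0d : ∀ t, HasDerivAt P0 (P0' t) t := fun t =>
    ((hcd t).mul_const X0).add ((hsd t).mul_const V0)
  have hPd : ∀ t, HasDerivAt P (P' t) t := fun t =>
    ((hcd t).smul_const X).add ((hsd t).smul_const V)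
  set c : ℝ → E d := fun t => (1 + P0 t)⁻¹ • P t with hc
  have hcnorm : ∀ t, 1 - ‖c t‖ ^ 2 = 2 / (1 + P0 t) := by
    intro t
    have := hP0pos t
    simp only [hc]
    rw [norm_smul, mul_pow, hPP, Real.norm_eq_abs, sq_abs]
    field_simp; ring
  have hcd' : ∀ t, HasDerivAt c ((1 + P0 t)⁻¹ • P' t + (-P0' t / (1 + P0 t) ^ 2) • P t) t := by
    intro t
    exact (((hP0d t).const_add 1).fun_inv (hP0pos t).ne').smul (hPd t)
  have hspeed : ∀ t, 2 * ‖deriv c t‖ / (1 - ‖c t‖ ^ 2) = L := by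
    intro t
    have hp := hP0pos t
    have hn : ‖deriv c t‖ ^ 2 = (L / (1 + P0 t)) ^ 2 := by
      rw [(hcd' t).deriv, norm_smul_add_smul_sq, hPP, hPn', real_inner_comm, hPP']
      field_simp; ring
    have hn' : ‖deriv c t‖ = L / (1 + P0 t) :=
      (sq_eq_sq₀ (norm_nonneg _) (by positivity)).1 hn
    rw [hn', hcnorm]
    field_simp
  refine ⟨c, ?_, ?_, ?_, ?_, ?_⟩
  · have h1 : ContDiff ℝ 1 P0 :=
      ((Real.contDiff_cosh.comp (contDiff_id.mul contDiff_const)).mul contDiff_const).add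
        ((Real.contDiff_sinh.comp (contDiff_id.mul contDiff_const)).mul contDiff_const)
    have h2 : ContDiff ℝ 1 P :=
      ((Real.contDiff_cosh.comp (contDiff_id.mul contDiff_const)).smul contDiff_const).add
        ((Real.contDiff_sinh.comp (contDiff_id.mul contDiff_const)).smul contDiff_const)
    exact ((contDiff_const.add h1).inv fun t => (hP0pos t).ne').smul h2
  · intro t _
    have h1 : 0 < 1 - ‖c t‖ ^ 2 := by rw [hcnorm]; have := hP0pos t; positivity
    nlinarith [norm_nonneg (c t)]
  · have : 1 + X0 = 2 / a := by rw [hX0]; field_simp; ring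
    simp only [hc, hP0, hP, zero_mul, Real.cosh_zero, Real.sinh_zero, one_mul, one_smul, zero_smul,
      add_zero]
    rw [this, hX, smul_smul, inv_mul_cancel₀ (by positivity), one_smul]
  · have hY1 : 1 + Y0 = 2 / b := by rw [hY0]; field_simp; ring
    have h1 : P0 1 = Y0 := by
      simp only [hP0, one_mul, hcosh, ← hS, hV0]
      field_simp; ring
    have h2 : P 1 = Y := by
      simp only [hP, one_mul, hcosh, ← hS, hV, smul_smul]
      rw [mul_one_div_cancel hSpos.ne', one_smul]
      abel
    simp only [hc]
    rw [h1, h2, hY1, hY, smul_smul, inv_mul_cancel₀ (by positivity), one_smul]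
  · unfold hypLength
    simp only [hspeed]
    simp

lemma hypDist_eq_arcosh {d : ℕ} {x y : E d} (hx : ‖x‖ < 1) (hy : ‖y‖ < 1) :
    hypDist x y = Real.arcosh (coshDist x y) := by
  refine IsLeast.csInf_eq ⟨?_, ?_⟩
  · obtain ⟨c, h1, h2, h3, h4, h5⟩ := exists_geodesic hx hy
    exact ⟨c, h1, h2, h3, h4, h5⟩
  · rintro _ ⟨c, h1, h2, rfl, rfl, rfl⟩
    exact arcosh_coshDist_le_hypLength h1 h2

lemma hypDist_le_iff {d : ℕ} {x y : E d} (hx : ‖x‖ < 1) (hy : ‖y‖ < 1) {r : ℝ} (hr : 0 ≤ r) :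
    hypDist x y ≤ r ↔ coshDist x y ≤ Real.cosh r := by
  have h := one_le_coshDist hx hy
  rw [hypDist_eq_arcosh hx hy, ← Real.arcosh_le_arcosh (by linarith) (Real.cosh_pos r),
    Real.arcosh_cosh hr]

/-! ### Spherical coordinates -/

lemma lintegral_fin_cons {m : ℕ} {g : (Fin (m + 1) → ℝ) → ENNReal} (hg : Measurable g) :
    ∫⁻ x, g x = ∫⁻ a : ℝ, ∫⁻ y : Fin m → ℝ, g (Fin.cons a y) := by
  have h := (volume_preserving_piFinSuccAbove (fun _ : Fin (m + 1) => ℝ) 0).symm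
  rw [← h.lintegral_comp hg]
  have := lintegral_prod (μ := (volume : Measure ℝ)) (ν := (volume : Measure (Fin m → ℝ)))
    (fun z => g ((MeasurableEquiv.piFinSuccAbove (fun _ : Fin (m + 1) => ℝ) 0).symm z))
    (hg.comp (MeasurableEquiv.measurable _)).aemeasurable
  refine this.trans ?_
  refine lintegral_congr fun a => lintegral_congr fun y => ?_
  congr 1
  ext i
  refine Fin.cases ?_ (fun j => ?_) i <;> simp [MeasurableEquiv.piFinSuccAbove]

lemma measurable_fin_cons {m : ℕ} :
    Measurable fun p : ℝ × (Fin m → ℝ) => (Fin.cons p.1 p.2 : Fin (m + 1) → ℝ) := by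
  refine measurable_pi_lambda _ fun i => ?_
  refine Fin.cases ?_ (fun j => ?_) i
  · simpa using measurable_fst
  · simpa [Function.comp_def] using (measurable_pi_apply j).comp measurable_snd

/-- Polar coordinates of the plane. -/
lemma lintegral_polar {g : ℝ × ℝ → ENNReal} (hg : Measurable g) :
    ∫⁻ a : ℝ, ∫⁻ b : ℝ, g (a, b) =
      ∫⁻ r in Set.Ioi (0 : ℝ), ∫⁻ φ in Set.Ioo (-Real.pi) Real.pi,
        ENNReal.ofReal r * g (r * Real.cos φ, r * Real.sin φ) := by
  have hm : Measurable fun p : ℝ × ℝ =>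
      ENNReal.ofReal p.1 * g (p.1 * Real.cos p.2, p.1 * Real.sin p.2) := by fun_prop
  rw [← lintegral_prod _ hg.aemeasurable, ← Measure.volume_eq_prod,
    ← lintegral_comp_polarCoord_symm, polarCoord_target, Measure.volume_eq_prod,
    ← Measure.prod_restrict, ← lintegral_prod _ hm.aemeasurable]
  rfl

/-- Polar coordinates of the plane, with the angle in `[0, 2π)`. -/
lemma lintegral_polar_Ico {g : ℝ × ℝ → ENNReal} (hg : Measurable g) :
    ∫⁻ a : ℝ, ∫⁻ b : ℝ, g (a, b) =
      ∫⁻ r in Set.Ioi (0 : ℝ), ∫⁻ φ in Set.Ico 0 (2 * Real.pi),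
        ENNReal.ofReal r * g (r * Real.cos φ, r * Real.sin φ) := by
  rw [lintegral_polar hg]
  refine lintegral_congr fun r => ?_
  rw [setLIntegral_congr Ioo_ae_eq_Ioc, setLIntegral_congr Ico_ae_eq_Ioc]
  have h1 := isAddFundamentalDomain_Ioc Real.two_pi_pos (-Real.pi) volume
  have h2 := isAddFundamentalDomain_Ioc Real.two_pi_pos 0 volume
  rw [show -Real.pi + 2 * Real.pi = Real.pi by ring] at h1
  rw [zero_add] at h2
  refine h1.setLIntegral_eq h2 _ ?_
  rintro ⟨_, n, rfl⟩ x
  simp only [AddSubgroup.vadd_def, vadd_eq_add, zsmul_eq_mul]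
  rw [add_comm, Real.cos_add_int_mul_two_pi, Real.sin_add_int_mul_two_pi]

/-- Polar coordinates of the upper half plane. -/
lemma lintegral_polar_upper {g : ℝ × ℝ → ENNReal} (hg : Measurable g) :
    ∫⁻ a : ℝ, ∫⁻ b in Set.Ioi (0 : ℝ), g (a, b) =
      ∫⁻ r in Set.Ioi (0 : ℝ), ∫⁻ φ in Set.Icc 0 Real.pi,
        ENNReal.ofReal r * g (r * Real.cos φ, r * Real.sin φ) := by
  have hs : MeasurableSet {p : ℝ × ℝ | 0 < p.2} := measurableSet_lt measurable_const measurable_snd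
  have h0 : ∀ a : ℝ, ∫⁻ b in Set.Ioi (0 : ℝ), g (a, b) =
      ∫⁻ b : ℝ, {p : ℝ × ℝ | 0 < p.2}.indicator g (a, b) := fun a => by
    rw [← lintegral_indicator measurableSet_Ioi]; rfl
  simp only [h0]
  rw [lintegral_polar (hg.indicator hs)]
  refine setLIntegral_congr_fun measurableSet_Ioi fun r hr => ?_
  have hr : 0 < r := hr
  rw [← setLIntegral_congr Ioo_ae_eq_Icc]
  rw [← lintegral_indicator measurableSet_Ioo, ← lintegral_indicator measurableSet_Ioo]
  refine lintegral_congr fun φ => ?_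
  simp only [Set.indicator_apply, Set.mem_ofPred_eq, Set.mem_Ioo]
  have hpi := Real.pi_pos
  by_cases h1 : 0 < φ ∧ φ < Real.pi
  · have : 0 < r * Real.sin φ := mul_pos hr (Real.sin_pos_of_pos_of_lt_pi h1.1 h1.2)
    rw [if_pos ⟨by linarith, h1.2⟩, if_pos this, if_pos h1]
  · rw [if_neg h1]
    split_ifs with h2 h3
    · have h4 : φ ≤ 0 := by by_contra h; exact h1 ⟨not_le.1 h, h2.2⟩
      have := Real.sin_nonpos_of_nonpos_of_neg_pi_le h4 h2.1.le
      nlinarith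
    · simp
    · rfl

/-- The unit vector with given spherical coordinates, as a plain vector. The dimension is written
as `m + 2`, so that there are `m + 1` angles without truncated subtraction. -/
noncomputable def sphereVec (m : ℕ) (θ : Fin (m + 1) → ℝ) : Fin (m + 2) → ℝ := fun j =>
  (∏ i : Fin (m + 1), if i.val < j.val then Real.sin (θ i) else 1) *
    (if h : j.val < m + 1 then Real.cos (θ ⟨j.val, h⟩) else 1)

/-- The Jacobian factor `∏ sin^{d-i-1} θ_i` of spherical coordinates in dimension `d = m + 2`. -/
noncomputable def sphereWeight (m : ℕ) (θ : Fin (m + 1) → ℝ) : ℝ :=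
  ∏ i : Fin (m + 1), Real.sin (θ i) ^ (m - i.val)

lemma sphereVec_cons (m : ℕ) (φ : ℝ) (θ : Fin (m + 1) → ℝ) :
    sphereVec (m + 1) (Fin.cons φ θ) = Fin.cons (Real.cos φ) (Real.sin φ • sphereVec m θ) := by
  ext j
  refine Fin.cases ?_ (fun j => ?_) j
  · simp [sphereVec]
  · simp only [sphereVec, Fin.cons_succ, Pi.smul_apply, smul_eq_mul]
    rw [Fin.prod_univ_succ]
    simp only [Fin.val_zero, Fin.val_succ, Nat.succ_pos, if_true, Fin.cons_zero, Fin.cons_succ,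
      add_lt_add_iff_right, mul_assoc]
    congr 2

lemma sphereWeight_cons (m : ℕ) (φ : ℝ) (θ : Fin (m + 1) → ℝ) :
    sphereWeight (m + 1) (Fin.cons φ θ) = Real.sin φ ^ (m + 1) * sphereWeight m θ := by
  simp only [sphereWeight]
  rw [Fin.prod_univ_succ]
  simp

/-- The set of spherical coordinates in dimension `m + 2`: the set `angles (m + 2)`, whose index
type `Fin (m + 2 - 1)` is definitionally `Fin (m + 1)`. -/
def sphereAngles (m : ℕ) : Set (Fin (m + 1) → ℝ) := angles (m + 2)

lemma cons_mem_sphereAngles (m : ℕ) (φ : ℝ) (θ : Fin (m + 1) → ℝ) :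
    (Fin.cons φ θ : Fin (m + 2) → ℝ) ∈ sphereAngles (m + 1) ↔
      φ ∈ Set.Icc 0 Real.pi ∧ θ ∈ sphereAngles m := by
  change (∀ i : Fin (m + 2), _ ∧ (if i.val + 1 < m + 2 then _ else _)) ↔ _ ∧
    ∀ i : Fin (m + 1), _ ∧ (if i.val + 1 < m + 1 then _ else _)
  rw [Fin.forall_fin_succ]
  simp

lemma measurableSet_angles (d : ℕ) : MeasurableSet (angles d) := by
  have : angles d = ⋂ i, {θ | 0 ≤ θ i ∧
      (if i.val + 1 < d - 1 then θ i ≤ Real.pi else θ i < 2 * Real.pi)} := by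
    ext; simp [angles]
  rw [this]
  refine MeasurableSet.iInter fun i => ?_
  by_cases h : i.val + 1 < d - 1
  · simp only [h, if_true]
    exact (measurableSet_le measurable_const (measurable_pi_apply i)).inter
      (measurableSet_le (measurable_pi_apply i) measurable_const)
  · simp only [h, if_false]
    exact (measurableSet_le measurable_const (measurable_pi_apply i)).inter
      (measurableSet_lt (measurable_pi_apply i) measurable_const)

lemma measurable_sphereVec (m : ℕ) : Measurable (sphereVec m) := by
  refine measurable_pi_lambda _ fun j => ?_
  refine Measurable.mul (Finset.measurable_prod _ fun i _ => ?_) ?_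
  · split_ifs
    · fun_prop
    · fun_prop
  · split_ifs
    · fun_prop
    · fun_prop

lemma measurable_sphereWeight (m : ℕ) : Measurable (sphereWeight m) := by
  unfold sphereWeight; fun_prop

lemma lintegral_angles_succ {m : ℕ} {h : (Fin (m + 2) → ℝ) → ENNReal} (hh : Measurable h) :
    ∫⁻ Θ in sphereAngles (m + 1), h Θ =
      ∫⁻ φ in Set.Icc 0 Real.pi, ∫⁻ θ in sphereAngles m,
        h (Fin.cons φ θ) := by
  have hA : MeasurableSet (sphereAngles (m + 1)) := measurableSet_angles _
  have hA' : MeasurableSet (sphereAngles m) := measurableSet_angles _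
  rw [← lintegral_indicator hA, lintegral_fin_cons (hh.indicator hA),
    ← lintegral_indicator measurableSet_Icc]
  refine lintegral_congr fun φ => ?_
  by_cases hφ : φ ∈ Set.Icc 0 Real.pi
  · rw [Set.indicator_of_mem hφ, ← lintegral_indicator hA']
    refine lintegral_congr fun θ => ?_
    by_cases hθ : θ ∈ sphereAngles m
    · exact (Set.indicator_of_mem ((cons_mem_sphereAngles m φ θ).2 ⟨hφ, hθ⟩) h).trans
        (Set.indicator_of_mem hθ fun θ => h (Fin.cons φ θ)).symm
    · exact (Set.indicator_of_notMem (fun H => hθ ((cons_mem_sphereAngles m φ θ).1 H).2) h).trans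
        (Set.indicator_of_notMem hθ fun θ => h (Fin.cons φ θ)).symm
  · rw [Set.indicator_of_notMem hφ]
    exact (lintegral_congr fun θ => Set.indicator_of_notMem
      (fun H => hφ ((cons_mem_sphereAngles m φ θ).1 H).1) h).trans lintegral_zero

lemma lintegral_angles_two {h : (Fin 1 → ℝ) → ENNReal} (hh : Measurable h) :
    ∫⁻ θ in sphereAngles 0, h θ =
      ∫⁻ φ in Set.Ico 0 (2 * Real.pi), h fun _ => φ := by
  have hA : MeasurableSet (sphereAngles 0) := measurableSet_angles _
  rw [← lintegral_indicator hA, ← lintegral_indicator measurableSet_Ico]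
  refine ((volume_preserving_funUnique (Fin 1) ℝ).symm.lintegral_comp
    (hh.indicator hA)).symm.trans ?_
  refine lintegral_congr fun φ => ?_
  have h1 : (MeasurableEquiv.funUnique (Fin 1) ℝ).symm φ = fun _ => φ := rfl
  rw [h1]
  have : (fun _ : Fin 1 => φ) ∈ sphereAngles 0 ↔ φ ∈ Set.Ico 0 (2 * Real.pi) := by
    change (∀ i : Fin 1, _ ∧ (if i.val + 1 < 1 then _ else _)) ↔ _
    simp
  by_cases hφ : φ ∈ Set.Ico 0 (2 * Real.pi)
  · exact (Set.indicator_of_mem (this.2 hφ) h).trans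
      (Set.indicator_of_mem hφ fun φ => h fun _ => φ).symm
  · exact (Set.indicator_of_notMem (fun H => hφ (this.1 H)) h).trans
      (Set.indicator_of_notMem hφ fun φ => h fun _ => φ).symm

/-- Integration in spherical coordinates. In the induction step the first coordinate `x₀` and the
length `ρ` of the remaining part are replaced by polar coordinates `(r cos φ, r sin φ)`, and `φ`
becomes the first angle. -/
theorem lintegral_spherical (m : ℕ) {f : (Fin (m + 2) → ℝ) → ENNReal} (hf : Measurable f) :
    ∫⁻ x, f x = ∫⁻ r in Set.Ioi (0 : ℝ), ∫⁻ θ in sphereAngles m,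
      ENNReal.ofReal (r ^ (m + 1)) * ENNReal.ofReal (sphereWeight m θ) *
        f (r • sphereVec m θ) := by
  induction m with
  | zero =>
    have hc2 : Measurable fun p : ℝ × ℝ => f ![p.1, p.2] := by
      refine hf.comp (measurable_pi_lambda _ fun i => ?_)
      fin_cases i
      · exact measurable_fst
      · exact measurable_snd
    have h1 : ∫⁻ x, f x = ∫⁻ a : ℝ, ∫⁻ b : ℝ, f ![a, b] := by
      rw [lintegral_fin_cons hf]
      refine lintegral_congr fun a => ?_
      refine ((volume_preserving_funUnique (Fin 1) ℝ).symm.lintegral_comp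
        (hf.comp (measurable_fin_cons.comp measurable_prodMk_left))).symm.trans ?_
      refine lintegral_congr fun b => ?_
      congr 1
      ext i; fin_cases i; all_goals rfl
    rw [h1, lintegral_polar_Ico hc2]
    refine lintegral_congr fun r => ?_
    rw [lintegral_angles_two]
    · refine lintegral_congr fun φ => ?_
      have : r • sphereVec 0 (fun _ => φ) = ![r * Real.cos φ, r * Real.sin φ] := by
        ext i; fin_cases i <;> simp [sphereVec]
      rw [this]
      simp [sphereWeight]
    · have := measurable_sphereVec 0
      have := measurable_sphereWeight 0
      fun_prop
  | succ m ih =>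
    have hv := measurable_sphereVec m
    have hw := measurable_sphereWeight m
    have hv' := measurable_sphereVec (m + 1)
    have hw' := measurable_sphereWeight (m + 1)
    have hcons : Measurable fun q : (ℝ × ℝ) × (Fin (m + 1) → ℝ) =>
        f (Fin.cons q.1.1 (q.1.2 • sphereVec m q.2)) :=
      hf.comp (measurable_fin_cons.comp (by fun_prop :
        Measurable fun q : (ℝ × ℝ) × (Fin (m + 1) → ℝ) => (q.1.1, q.1.2 • sphereVec m q.2)))
    -- the integrand as a function of `(x₀, ρ, θ)`, where `ρ` is the length of the remaining part
    set K : (ℝ × ℝ) × (Fin (m + 1) → ℝ) → ENNReal := fun q =>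
      ENNReal.ofReal (q.1.2 ^ (m + 1)) * ENNReal.ofReal (sphereWeight m q.2) *
        f (Fin.cons q.1.1 (q.1.2 • sphereVec m q.2)) with hK
    have hKm : Measurable K := by
      refine Measurable.mul ?_ hcons
      fun_prop
    calc ∫⁻ x, f x = ∫⁻ a : ℝ, ∫⁻ y : Fin (m + 2) → ℝ, f (Fin.cons a y) := lintegral_fin_cons hf
      _ = ∫⁻ a : ℝ, ∫⁻ ρ in Set.Ioi (0 : ℝ), ∫⁻ θ in sphereAngles m,
            K ((a, ρ), θ) := by
          refine lintegral_congr fun a => ?_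
          exact ih (hf.comp (measurable_fin_cons.comp measurable_prodMk_left))
      _ = ∫⁻ r in Set.Ioi (0 : ℝ), ∫⁻ φ in Set.Icc 0 Real.pi, ENNReal.ofReal r *
            ∫⁻ θ in sphereAngles m,
              K ((r * Real.cos φ, r * Real.sin φ), θ) :=
          lintegral_polar_upper (g := fun p =>
            ∫⁻ θ in sphereAngles m, K (p, θ)) hKm.lintegral_prod_right'
      _ = _ := by
          refine setLIntegral_congr_fun measurableSet_Ioi fun r hr => ?_
          have hr : 0 < r := hr
          have hm3 : Measurable fun Θ : Fin (m + 2) → ℝ =>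
            ENNReal.ofReal (r ^ (m + 1 + 1)) * ENNReal.ofReal (sphereWeight (m + 1) Θ) *
              f (r • sphereVec (m + 1) Θ) := by fun_prop
          refine Eq.trans ?_ (lintegral_angles_succ hm3).symm
          refine setLIntegral_congr_fun measurableSet_Icc fun φ hφ => ?_
          have hKm' : Measurable fun θ => K ((r * Real.cos φ, r * Real.sin φ), θ) :=
            hKm.comp measurable_prodMk_left
          rw [← lintegral_const_mul _ hKm']
          refine lintegral_congr fun θ => ?_
          have hsin : 0 ≤ Real.sin φ := Real.sin_nonneg_of_mem_Icc hφ
          have e1 : r • sphereVec (m + 1) (Fin.cons φ θ) =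
              Fin.cons (r * Real.cos φ) ((r * Real.sin φ) • sphereVec m θ) := by
            rw [sphereVec_cons]
            ext i
            refine Fin.cases ?_ (fun j => ?_) i <;> simp [mul_assoc]
          have e2 : ENNReal.ofReal (r ^ (m + 1 + 1)) *
              ENNReal.ofReal (Real.sin φ ^ (m + 1) * sphereWeight m θ) =
              ENNReal.ofReal r * (ENNReal.ofReal ((r * Real.sin φ) ^ (m + 1)) *
                ENNReal.ofReal (sphereWeight m θ)) := by
            rw [ENNReal.ofReal_mul (p := Real.sin φ ^ (m + 1)) (by positivity), ← mul_assoc,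
              ← mul_assoc, ← ENNReal.ofReal_mul (by positivity), ← ENNReal.ofReal_mul hr.le]
            congr 2
            ring
          rw [e1, sphereWeight_cons, e2, mul_assoc]

/-! ### Spherical caps -/

/-- The unit vector with spherical coordinates `θ` as a point of Euclidean space. -/
noncomputable def spherePoint (m : ℕ) (θ : Fin (m + 1) → ℝ) : E (m + 2) :=
  WithLp.toLp 2 (sphereVec m θ)

lemma measurable_spherePoint (m : ℕ) : Measurable (spherePoint m) :=
  (WithLp.measurable_toLp 2 _).comp (measurable_sphereVec m)

lemma sum_sq_sphereVec (m : ℕ) (θ : Fin (m + 1) → ℝ) : ∑ j, sphereVec m θ j ^ 2 = 1 := by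
  induction m with
  | zero =>
    simp [sphereVec, Fin.sum_univ_two]
  | succ m ih =>
    rw [← Fin.cons_self_tail θ, sphereVec_cons, Fin.sum_univ_succ]
    simp only [Fin.cons_zero, Fin.cons_succ, Pi.smul_apply, smul_eq_mul, mul_pow]
    rw [← Finset.mul_sum, ih]
    simp

lemma norm_spherePoint (m : ℕ) (θ : Fin (m + 1) → ℝ) : ‖spherePoint m θ‖ = 1 := by
  have h : ‖spherePoint m θ‖ ^ 2 = 1 ^ 2 := by
    rw [EuclideanSpace.real_norm_sq_eq, one_pow]
    exact sum_sq_sphereVec m θ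
  exact (sq_eq_sq₀ (norm_nonneg _) zero_le_one).1 h

/-- The unnormalised measure of the spherical cap `{s | τ ≤ ⟪s, v⟫}`. -/
noncomputable def capMass (m : ℕ) (v : E (m + 2)) (τ : ℝ) : ENNReal :=
  ∫⁻ θ in sphereAngles m, ENNReal.ofReal (sphereWeight m θ) *
    {θ | τ ≤ inner ℝ (spherePoint m θ) v}.indicator 1 θ

lemma measurableSet_cap (m : ℕ) (v : E (m + 2)) (τ : ℝ) :
    MeasurableSet {θ | τ ≤ inner ℝ (spherePoint m θ) v} :=
  measurableSet_le measurable_const ((measurable_spherePoint m).inner measurable_const)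

/-- The part of the unit ball lying over a spherical cap. -/
def sector (m : ℕ) (v : E (m + 2)) (τ : ℝ) : Set (E (m + 2)) :=
  {x | ‖x‖ ≤ 1 ∧ τ * ‖x‖ ≤ inner ℝ x v}

lemma measurableSet_sector (m : ℕ) (v : E (m + 2)) (τ : ℝ) : MeasurableSet (sector m v τ) :=
  (measurableSet_le measurable_norm measurable_const).inter
    (measurableSet_le (measurable_norm.const_mul τ) (measurable_id.inner measurable_const))

/-- The volume of a sector, in spherical coordinates. -/
lemma volume_sector (m : ℕ) (v : E (m + 2)) (τ : ℝ) :
    volume (sector m v τ) =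
      (∫⁻ r in Set.Ioc (0 : ℝ) 1, ENNReal.ofReal (r ^ (m + 1))) * capMass m v τ := by
  have hS := measurableSet_sector m v τ
  have h1 : volume (sector m v τ) = ∫⁻ x : Fin (m + 2) → ℝ,
      (sector m v τ).indicator 1 (WithLp.toLp 2 x : E (m + 2)) := by
    rw [← lintegral_indicator_one hS,
      ← (PiLp.volume_preserving_toLp (Fin (m + 2))).lintegral_comp (measurable_one.indicator hS)]
  have hm : Measurable fun x : Fin (m + 2) → ℝ =>
      ((sector m v τ).indicator 1 (WithLp.toLp 2 x : E (m + 2)) : ENNReal) :=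
    (measurable_one.indicator hS).comp (WithLp.measurable_toLp 2 _)
  rw [h1, lintegral_spherical m hm, ← lintegral_mul_const _ (by fun_prop),
    ← Set.Ioi_inter_Iic, Set.inter_comm, ← Measure.restrict_restrict measurableSet_Iic,
    ← lintegral_indicator measurableSet_Iic]
  refine setLIntegral_congr_fun measurableSet_Ioi fun r hr => ?_
  have hr : 0 < r := hr
  have key : ∀ θ, (sector m v τ).indicator (1 : E (m + 2) → ENNReal)
      (WithLp.toLp 2 (r • sphereVec m θ) : E (m + 2)) = (Set.Iic 1).indicator 1 r *
        {θ | τ ≤ inner ℝ (spherePoint m θ) v}.indicator 1 θ := by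
    intro θ
    have e : (WithLp.toLp 2 (r • sphereVec m θ) : E (m + 2)) = r • spherePoint m θ := rfl
    have hn : ‖r • spherePoint m θ‖ = r := by
      rw [norm_smul, norm_spherePoint, mul_one, Real.norm_eq_abs, abs_of_pos hr]
    have hiff : r • spherePoint m θ ∈ sector m v τ ↔
        r ≤ 1 ∧ τ ≤ inner ℝ (spherePoint m θ) v := by
      change _ ∧ _ ↔ _
      rw [hn, real_inner_smul_left, mul_comm τ r, mul_le_mul_iff_right₀ hr]
    rw [e]
    by_cases h2 : r ≤ 1 <;> by_cases h3 : τ ≤ inner ℝ (spherePoint m θ) v <;>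
      simp [hiff, h2, h3]
  simp only [key]
  by_cases h2 : r ≤ 1
  · have h2' : r ∈ Set.Iic (1 : ℝ) := h2
    have hcap : Measurable fun θ => ENNReal.ofReal (sphereWeight m θ) *
        {θ | τ ≤ inner ℝ (spherePoint m θ) v}.indicator 1 θ :=
      (measurable_sphereWeight m).ennreal_ofReal.mul
        (measurable_one.indicator (measurableSet_cap m v τ))
    rw [Set.indicator_of_mem h2', Set.indicator_of_mem h2', capMass,
      ← lintegral_const_mul _ hcap]
    refine lintegral_congr fun θ => ?_
    simp only [Pi.one_apply, one_mul, mul_assoc]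
  · have h2' : r ∉ Set.Iic (1 : ℝ) := h2
    rw [Set.indicator_of_notMem h2', Set.indicator_of_notMem h2']
    simp

/-- Rotation invariance of the measure of spherical caps, from that of Lebesgue measure. -/
lemma capMass_congr (m : ℕ) {v w : E (m + 2)} (h : ‖v‖ = ‖w‖) (τ : ℝ) :
    capMass m v τ = capMass m w τ := by
  set ρ := (ℝ ∙ (v - w))ᗮ.reflection with hρ
  have hv : ρ v = w := Submodule.reflection_sub h
  have hpre : ρ ⁻¹' sector m w τ = sector m v τ := by
    ext x
    change ‖ρ x‖ ≤ 1 ∧ τ * ‖ρ x‖ ≤ inner ℝ (ρ x) w ↔ _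
    rw [← hv, LinearIsometryEquiv.norm_map, LinearIsometryEquiv.inner_map_map]
    rfl
  have hvol : volume (sector m v τ) = volume (sector m w τ) := by
    rw [← hpre]
    exact ρ.measurePreserving.measure_preimage (measurableSet_sector m w τ).nullMeasurableSet
  rw [volume_sector, volume_sector] at hvol
  have hr : ∫⁻ r in Set.Ioc (0 : ℝ) 1, ENNReal.ofReal (r ^ (m + 1)) =
      ENNReal.ofReal (1 / (m + 2)) := by
    rw [← ofReal_integral_eq_lintegral_ofReal, ← intervalIntegral.integral_of_le zero_le_one,
      integral_pow]
    · congr 1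
      push_cast
      simp
      ring
    · exact ((by fun_prop : Continuous fun r : ℝ => r ^ (m + 1)).continuousOn.integrableOn_Icc
        ).mono_set Set.Ioc_subset_Icc_self
    · refine (ae_restrict_iff' measurableSet_Ioc).2 (Eventually.of_forall fun x hx => ?_)
      exact pow_nonneg hx.1.le _
  rw [hr] at hvol
  refine (ENNReal.mul_right_inj ?_ ENNReal.ofReal_ne_top).1 hvol
  exact (ENNReal.ofReal_pos.2 (by positivity)).ne'

/-- The angular opening of a cap is `arccos τ`. For `τ < -1`, where the cap is the whole sphere,
this remains true since `Real.arccos τ = π`. -/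
lemma le_cos_iff_le_arccos {τ x : ℝ} (hτ : τ ≤ 1) (hx : x ∈ Set.Icc 0 Real.pi) :
    τ ≤ Real.cos x ↔ x ≤ Real.arccos τ := by
  constructor
  · intro h
    rw [← Real.arccos_cos hx.1 hx.2]
    exact Real.arccos_le_arccos h
  · intro h
    have h1 := Real.cos_le_cos_of_nonneg_of_le_pi hx.1 (Real.arccos_le_pi τ) h
    rcases le_or_gt (-1) τ with h2 | h2
    · rwa [Real.cos_arccos h2 hτ] at h1
    · linarith [Real.neg_one_le_cos x]

lemma lintegral_sin_pow (m : ℕ) {a : ℝ} (ha : 0 ≤ a) (ha' : a ≤ Real.pi) :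
    ∫⁻ φ in Set.Icc 0 a, ENNReal.ofReal (Real.sin φ ^ m) =
      ENNReal.ofReal (∫ x in (0 : ℝ)..a, Real.sin x ^ m) := by
  rw [intervalIntegral.integral_of_le ha, ← integral_Icc_eq_integral_Ioc,
    ofReal_integral_eq_lintegral_ofReal]
  · exact (by fun_prop : Continuous fun x => Real.sin x ^ m).continuousOn.integrableOn_Icc
  · refine (ae_restrict_iff' measurableSet_Icc).2 (Eventually.of_forall fun x hx => ?_)
    exact pow_nonneg (Real.sin_nonneg_of_mem_Icc ⟨hx.1, hx.2.trans ha'⟩) m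

lemma lintegral_sin_pow_cap (m : ℕ) {τ : ℝ} (hτ : τ ≤ 1) :
    ∫⁻ φ in Set.Icc 0 Real.pi, ENNReal.ofReal (Real.sin φ ^ m) *
        {φ | τ ≤ Real.cos φ}.indicator 1 φ =
      ENNReal.ofReal (∫ x in (0 : ℝ)..Real.arccos τ, Real.sin x ^ m) := by
  rw [← lintegral_sin_pow m (Real.arccos_nonneg τ) (Real.arccos_le_pi τ),
    ← lintegral_indicator measurableSet_Icc, ← lintegral_indicator measurableSet_Icc]
  refine lintegral_congr fun φ => ?_
  by_cases h : φ ∈ Set.Icc 0 Real.pi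
  · have h1 := le_cos_iff_le_arccos hτ h
    rw [Set.indicator_of_mem h]
    by_cases h2 : φ ≤ Real.arccos τ
    · rw [Set.indicator_of_mem (show φ ∈ Set.Icc 0 (Real.arccos τ) from ⟨h.1, h2⟩),
        Set.indicator_of_mem (show φ ∈ {φ | τ ≤ Real.cos φ} from h1.2 h2)]
      simp
    · rw [Set.indicator_of_notMem (show φ ∉ Set.Icc 0 (Real.arccos τ) from fun H => h2 H.2),
        Set.indicator_of_notMem (show φ ∉ {φ | τ ≤ Real.cos φ} from fun H => h2 (h1.1 H))]
      simp
  · rw [Set.indicator_of_notMem h, Set.indicator_of_notMem fun H =>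
      h ⟨H.1, H.2.trans (Real.arccos_le_pi τ)⟩]

/-- The total mass of the weight of spherical coordinates. -/
lemma lintegral_sphereWeight (m : ℕ) :
    ∫⁻ θ in sphereAngles m, ENNReal.ofReal (sphereWeight m θ) =
      ENNReal.ofReal (2 * ∏ i : Fin (m + 1), ∫ x in (0 : ℝ)..Real.pi,
        Real.sin x ^ (m - i.val)) := by
  induction m with
  | zero =>
    rw [lintegral_angles_two (measurable_sphereWeight 0).ennreal_ofReal]
    simp [sphereWeight]
  | succ m ih =>
    have h0 : 0 ≤ ∫ x in (0 : ℝ)..Real.pi, Real.sin x ^ (m + 1) := (integral_sin_pow_pos _).le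
    rw [lintegral_angles_succ (measurable_sphereWeight (m + 1)).ennreal_ofReal,
      Fin.prod_univ_succ]
    simp only [Fin.val_zero, Fin.val_succ, Nat.sub_zero, Nat.add_sub_add_right]
    rw [mul_left_comm, ENNReal.ofReal_mul h0, ← ih,
      ← lintegral_sin_pow (m + 1) Real.pi_pos.le le_rfl,
      ← lintegral_mul_const _ (by fun_prop)]
    refine setLIntegral_congr_fun measurableSet_Icc fun φ hφ => ?_
    simp only [sphereWeight_cons]
    rw [← lintegral_const_mul _ (measurable_sphereWeight m).ennreal_ofReal]
    refine lintegral_congr fun θ => ?_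
    rw [ENNReal.ofReal_mul (pow_nonneg (Real.sin_nonneg_of_mem_Icc hφ) _)]

/-- The mass of a spherical cap, for the cap around the first coordinate axis. -/
lemma capMass_axis (m : ℕ) {τ : ℝ} (hτ : τ ≤ 1) :
    capMass m (EuclideanSpace.single 0 1) τ * ENNReal.ofReal (∫ x in (0 : ℝ)..Real.pi,
        Real.sin x ^ m) =
      ENNReal.ofReal (∫ x in (0 : ℝ)..Real.arccos τ, Real.sin x ^ m) *
        ∫⁻ θ in sphereAngles m, ENNReal.ofReal (sphereWeight m θ) := by
  have h0 : ∀ θ, inner ℝ (spherePoint m θ) (EuclideanSpace.single 0 (1 : ℝ)) =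
      Real.cos (θ 0) := by
    intro θ
    rw [EuclideanSpace.inner_single_right]
    simp [spherePoint, sphereVec]
  unfold capMass
  simp only [h0]
  have hms : MeasurableSet {φ : ℝ | τ ≤ Real.cos φ} :=
    measurableSet_le measurable_const Real.measurable_cos
  have hms' : ∀ m, MeasurableSet {θ : Fin (m + 1) → ℝ | τ ≤ Real.cos (θ 0)} := fun m =>
    measurableSet_le measurable_const (Real.measurable_cos.comp (measurable_pi_apply 0))
  have hwm : ∀ m, Measurable fun θ => ENNReal.ofReal (sphereWeight m θ) *
      {θ : Fin (m + 1) → ℝ | τ ≤ Real.cos (θ 0)}.indicator 1 θ := fun m =>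
    (measurable_sphereWeight m).ennreal_ofReal.mul (measurable_one.indicator (hms' m))
  cases m with
  | zero =>
    rw [lintegral_sphereWeight, lintegral_angles_two (hwm 0)]
    have e1 : ∫⁻ φ in Set.Ico 0 (2 * Real.pi), ENNReal.ofReal (sphereWeight 0 fun _ => φ) *
        {θ : Fin 1 → ℝ | τ ≤ Real.cos (θ 0)}.indicator 1 (fun _ => φ) =
        ENNReal.ofReal (2 * Real.arccos τ) := by
      have e2 : ∀ φ : ℝ, ENNReal.ofReal (sphereWeight 0 fun _ => φ) *
          {θ : Fin 1 → ℝ | τ ≤ Real.cos (θ 0)}.indicator 1 (fun _ => φ) =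
          {φ : ℝ | τ ≤ Real.cos φ}.indicator 1 φ := by
        intro φ; simp [sphereWeight, Set.indicator_apply]
      simp only [e2]
      rw [setLIntegral_congr Ico_ae_eq_Ioc]
      have h1 := isAddFundamentalDomain_Ioc Real.two_pi_pos (-Real.pi) volume
      have h2 := isAddFundamentalDomain_Ioc Real.two_pi_pos 0 volume
      rw [show -Real.pi + 2 * Real.pi = Real.pi by ring] at h1
      rw [zero_add] at h2
      rw [h2.setLIntegral_eq h1, setLIntegral_congr Ioc_ae_eq_Icc,
        lintegral_indicator_one₀ hms.nullMeasurableSet, Measure.restrict_apply hms]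
      · have : {φ : ℝ | τ ≤ Real.cos φ} ∩ Set.Icc (-Real.pi) Real.pi =
            Set.Icc (-Real.arccos τ) (Real.arccos τ) := by
          ext x
          have hle := Real.arccos_le_pi τ
          rw [Set.mem_inter_iff, Set.mem_Icc, Set.mem_Icc, ← abs_le, ← abs_le]
          constructor
          · rintro ⟨h3, h4⟩
            have h3 : τ ≤ Real.cos x := h3
            rw [← Real.cos_abs] at h3
            exact (le_cos_iff_le_arccos hτ ⟨abs_nonneg x, h4⟩).1 h3
          · intro h3
            refine ⟨?_, h3.trans hle⟩
            change τ ≤ Real.cos x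
            rw [← Real.cos_abs]
            exact (le_cos_iff_le_arccos hτ ⟨abs_nonneg x, h3.trans hle⟩).2 h3
        rw [this, Real.volume_Icc]
        congr 1; ring
      · rintro ⟨_, n, rfl⟩ x
        have : Real.cos (n * (2 * Real.pi) + x) = Real.cos x := by
          rw [add_comm, Real.cos_add_int_mul_two_pi]
        simp [AddSubgroup.vadd_def, Set.indicator_apply, this]
    rw [e1, ← ENNReal.ofReal_mul (by have := Real.arccos_nonneg τ; positivity),
      ← ENNReal.ofReal_mul (by simpa using Real.arccos_nonneg τ)]
    congr 1
    simp
    ring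
  | succ m =>
    have h0 : 0 ≤ ∫ x in (0 : ℝ)..Real.pi, Real.sin x ^ (m + 1) := (integral_sin_pow_pos _).le
    rw [lintegral_angles_succ (hwm (m + 1)),
      lintegral_angles_succ (measurable_sphereWeight (m + 1)).ennreal_ofReal,
      ← lintegral_sin_pow_cap (m + 1) hτ, ← lintegral_sin_pow (m + 1) Real.pi_pos.le le_rfl]
    have hprod : ∀ φ ∈ Set.Icc 0 Real.pi, ∀ θ : Fin (m + 1) → ℝ,
        ENNReal.ofReal (sphereWeight (m + 1) (Fin.cons φ θ)) =
          ENNReal.ofReal (Real.sin φ ^ (m + 1)) * ENNReal.ofReal (sphereWeight m θ) := by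
      intro φ hφ θ
      rw [sphereWeight_cons,
        ENNReal.ofReal_mul (pow_nonneg (Real.sin_nonneg_of_mem_Icc hφ) _)]
    have e1 : ∫⁻ φ in Set.Icc 0 Real.pi, ∫⁻ θ in sphereAngles m,
        ENNReal.ofReal (sphereWeight (m + 1) (Fin.cons φ θ)) =
        (∫⁻ φ in Set.Icc 0 Real.pi, ENNReal.ofReal (Real.sin φ ^ (m + 1))) *
          ∫⁻ θ in sphereAngles m, ENNReal.ofReal (sphereWeight m θ) := by
      rw [← lintegral_mul_const _ (by fun_prop)]
      refine setLIntegral_congr_fun measurableSet_Icc fun φ hφ => ?_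
      simp only [hprod φ hφ]
      rw [lintegral_const_mul _ (measurable_sphereWeight m).ennreal_ofReal]
    have e2 : ∫⁻ φ in Set.Icc 0 Real.pi, ∫⁻ θ in sphereAngles m,
        ENNReal.ofReal (sphereWeight (m + 1) (Fin.cons φ θ)) *
          {θ : Fin (m + 2) → ℝ | τ ≤ Real.cos (θ 0)}.indicator 1 (Fin.cons φ θ) =
        (∫⁻ φ in Set.Icc 0 Real.pi, ENNReal.ofReal (Real.sin φ ^ (m + 1)) *
          {φ | τ ≤ Real.cos φ}.indicator 1 φ) *
          ∫⁻ θ in sphereAngles m, ENNReal.ofReal (sphereWeight m θ) := by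
      have hmm : Measurable fun φ => ENNReal.ofReal (Real.sin φ ^ (m + 1)) *
          {φ | τ ≤ Real.cos φ}.indicator 1 φ :=
        Measurable.mul (by fun_prop) (measurable_one.indicator hms)
      rw [← lintegral_mul_const _ hmm]
      refine setLIntegral_congr_fun measurableSet_Icc fun φ hφ => ?_
      simp only [hprod φ hφ]
      rw [← lintegral_const_mul _ (measurable_sphereWeight m).ennreal_ofReal]
      refine lintegral_congr fun θ => ?_
      have : {θ : Fin (m + 2) → ℝ | τ ≤ Real.cos (θ 0)}.indicator (1 : (Fin (m + 2) → ℝ) → ENNReal)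
          (Fin.cons φ θ) = {φ | τ ≤ Real.cos φ}.indicator 1 φ := by
        simp [Set.indicator_apply]
      rw [this]
      ring
    rw [e2, e1]
    ring

/-- The uniform measure of a spherical cap `{s | τ ≤ ⟪s, v⟫}` in dimension `d`. -/
noncomputable def capProb (d : ℕ) (τ : ℝ) : ℝ :=
  (∫ x in (0 : ℝ)..Real.arccos τ, Real.sin x ^ (d - 2)) / kappa d

lemma kappa_pos (d : ℕ) : 0 < kappa d := integral_sin_pow_pos _

lemma continuous_sin_pow_primitive (m : ℕ) :
    Continuous fun a => ∫ x in (0 : ℝ)..a, Real.sin x ^ m :=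
  intervalIntegral.continuous_primitive
    (fun a b => (by fun_prop : Continuous fun x => Real.sin x ^ m).intervalIntegrable a b) 0

lemma continuous_capProb (d : ℕ) : Continuous (capProb d) :=
  ((continuous_sin_pow_primitive (d - 2)).comp Real.continuous_arccos).div_const _

lemma integral_sin_pow_nonneg (m : ℕ) {a : ℝ} (ha : 0 ≤ a) (ha' : a ≤ Real.pi) :
    0 ≤ ∫ x in (0 : ℝ)..a, Real.sin x ^ m :=
  intervalIntegral.integral_nonneg ha fun _ hx =>
    pow_nonneg (Real.sin_nonneg_of_mem_Icc ⟨hx.1, hx.2.trans ha'⟩) m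

lemma capProb_nonneg (d : ℕ) (τ : ℝ) : 0 ≤ capProb d τ :=
  div_nonneg (integral_sin_pow_nonneg _ (Real.arccos_nonneg τ) (Real.arccos_le_pi τ))
    (kappa_pos d).le

lemma capProb_le_one (d : ℕ) (τ : ℝ) : capProb d τ ≤ 1 := by
  refine div_le_one_of_le₀ ?_ (kappa_pos d).le
  refine intervalIntegral.integral_mono_interval le_rfl (Real.arccos_nonneg τ)
    (Real.arccos_le_pi τ) ?_
    ((by fun_prop : Continuous fun x => Real.sin x ^ (d - 2)).intervalIntegrable _ _)
  refine (ae_restrict_iff' measurableSet_Ioc).2 (Eventually.of_forall fun x hx => ?_)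
  exact pow_nonneg (Real.sin_nonneg_of_mem_Icc ⟨hx.1.le, hx.2⟩) _

/-- The normalising constant of the angular density in dimension `m + 2`. -/
noncomputable def sphereConst (m : ℕ) : ℝ :=
  2 * ∏ i : Fin (m + 1), ∫ x in (0 : ℝ)..Real.pi, Real.sin x ^ (m - i.val)

lemma sphereConst_pos (m : ℕ) : 0 < sphereConst m :=
  mul_pos two_pos (Finset.prod_pos fun _ _ => integral_sin_pow_pos _)

lemma angularLaw_eq (m : ℕ) : angularLaw (m + 2) =
    (volume.restrict (sphereAngles m)).withDensity fun θ =>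
      ENNReal.ofReal (sphereWeight m θ / sphereConst m) := rfl

lemma ofReal_sphereWeight_div (m : ℕ) (θ : Fin (m + 1) → ℝ) :
    ENNReal.ofReal (sphereWeight m θ / sphereConst m) =
      (ENNReal.ofReal (sphereConst m))⁻¹ * ENNReal.ofReal (sphereWeight m θ) := by
  rw [ENNReal.ofReal_div_of_pos (sphereConst_pos m), ENNReal.div_eq_inv_mul]

lemma isProbabilityMeasure_angularLaw {d : ℕ} (hd : 2 ≤ d) :
    IsProbabilityMeasure (angularLaw d) := by
  obtain ⟨m, rfl⟩ := Nat.exists_eq_add_of_le' hd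
  refine ⟨?_⟩
  rw [angularLaw_eq]
  refine (withDensity_apply _ MeasurableSet.univ).trans ?_
  rw [Measure.restrict_univ]
  simp only [ofReal_sphereWeight_div]
  rw [lintegral_const_mul _ (measurable_sphereWeight m).ennreal_ofReal, lintegral_sphereWeight]
  exact ENNReal.inv_mul_cancel (ENNReal.ofReal_pos.2 (sphereConst_pos m)).ne'
    ENNReal.ofReal_ne_top

/-- The angular law of a spherical cap around an arbitrary unit vector. -/
lemma angularLaw_cap {d : ℕ} (hd : 2 ≤ d) {v : E d} (hv : ‖v‖ = 1) {τ : ℝ} (hτ : τ ≤ 1) :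
    angularLaw d {θ | τ ≤ inner ℝ (direction d θ) v} = ENNReal.ofReal (capProb d τ) := by
  obtain ⟨m, rfl⟩ := Nat.exists_eq_add_of_le' hd
  have hs := measurableSet_cap m v τ
  have hc := ENNReal.ofReal_pos.2 (sphereConst_pos m)
  have hk : 0 < kappa (m + 2) := kappa_pos _
  have hmass : ∫⁻ θ in sphereAngles m, ENNReal.ofReal (sphereWeight m θ) =
      ENNReal.ofReal (sphereConst m) := lintegral_sphereWeight m
  have h1 : angularLaw (m + 2) {θ | τ ≤ inner ℝ (direction (m + 2) θ) v} =
      (ENNReal.ofReal (sphereConst m))⁻¹ * capMass m v τ := by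
    rw [angularLaw_eq]
    refine (withDensity_apply _ hs).trans ?_
    have hcap : Measurable fun θ => ENNReal.ofReal (sphereWeight m θ) *
        {θ | τ ≤ inner ℝ (spherePoint m θ) v}.indicator 1 θ :=
      (measurable_sphereWeight m).ennreal_ofReal.mul (measurable_one.indicator hs)
    rw [← lintegral_indicator hs, capMass, ← lintegral_const_mul _ hcap]
    refine lintegral_congr fun θ => ?_
    by_cases h : τ ≤ inner ℝ (spherePoint m θ) v
    · rw [Set.indicator_of_mem (show θ ∈ {θ | τ ≤ inner ℝ (spherePoint m θ) v} from h),
        Set.indicator_of_mem (show θ ∈ {θ | τ ≤ inner ℝ (spherePoint m θ) v} from h),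
        ofReal_sphereWeight_div]
      simp
    · rw [Set.indicator_of_notMem (show θ ∉ {θ | τ ≤ inner ℝ (spherePoint m θ) v} from h),
        Set.indicator_of_notMem (show θ ∉ {θ | τ ≤ inner ℝ (spherePoint m θ) v} from h)]
      simp
  have h2 := capMass_axis m hτ
  rw [hmass, ← capMass_congr m (v := v) (by simp [hv])] at h2
  rw [h1, capProb, ENNReal.ofReal_div_of_pos hk, ENNReal.eq_div_iff
    (ENNReal.ofReal_pos.2 hk).ne' ENNReal.ofReal_ne_top, mul_left_comm,
    mul_comm (ENNReal.ofReal (kappa (m + 2)))]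
  change _ * (capMass m v τ * ENNReal.ofReal (∫ x in (0 : ℝ)..Real.pi, Real.sin x ^ m)) = _
  rw [h2, mul_left_comm, ENNReal.inv_mul_cancel hc.ne' ENNReal.ofReal_ne_top, mul_one]
  rfl

lemma measurable_direction {d : ℕ} (hd : 2 ≤ d) : Measurable (direction d) := by
  obtain ⟨m, rfl⟩ := Nat.exists_eq_add_of_le' hd
  exact measurable_spherePoint m

lemma norm_direction {d : ℕ} (hd : 2 ≤ d) (θ : Fin (d - 1) → ℝ) : ‖direction d θ‖ = 1 := by
  obtain ⟨m, rfl⟩ := Nat.exists_eq_add_of_le' hd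
  exact norm_spherePoint m θ

/-! ### The law of a vertex -/

/-- The hyperbolic law of cosines for two points given in polar coordinates. -/
lemma coshDist_polar {d : ℕ} {v w : E d} (hv : ‖v‖ = 1) (hw : ‖w‖ = 1) (a b : ℝ) :
    coshDist (Real.tanh (a / 2) • v) (Real.tanh (b / 2) • w) =
      Real.cosh a * Real.cosh b - Real.sinh a * Real.sinh b * inner ℝ v w := by
  have hn : ∀ (t : ℝ) (z : E d), ‖z‖ = 1 → ‖Real.tanh (t / 2) • z‖ ^ 2 = Real.tanh (t / 2) ^ 2 := by
    intro t z hz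
    rw [norm_smul, hz, mul_one, Real.norm_eq_abs, sq_abs]
  have ha : Real.cosh a = 1 + 2 * Real.sinh (a / 2) ^ 2 := by
    have := Real.cosh_two_mul (a / 2)
    rw [show 2 * (a / 2) = a by ring, Real.cosh_sq] at this
    linarith
  have hb : Real.cosh b = 1 + 2 * Real.sinh (b / 2) ^ 2 := by
    have := Real.cosh_two_mul (b / 2)
    rw [show 2 * (b / 2) = b by ring, Real.cosh_sq] at this
    linarith
  have ha' : Real.sinh a = 2 * Real.sinh (a / 2) * Real.cosh (a / 2) := by
    rw [← Real.sinh_two_mul]; congr 1; ring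
  have hb' : Real.sinh b = 2 * Real.sinh (b / 2) * Real.cosh (b / 2) := by
    rw [← Real.sinh_two_mul]; congr 1; ring
  have hca := Real.cosh_sq (a / 2)
  have hcb := Real.cosh_sq (b / 2)
  have hpa := Real.cosh_pos (a / 2)
  have hpb := Real.cosh_pos (b / 2)
  rw [coshDist, norm_sub_sq_real, hn a v hv, hn b w hw, real_inner_smul_left,
    real_inner_smul_right, Real.tanh_eq_sinh_div_cosh, Real.tanh_eq_sinh_div_cosh, ha, hb, ha', hb']
  set s := Real.sinh (a / 2)
  set S := Real.sinh (b / 2)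
  set c := Real.cosh (a / 2)
  set C := Real.cosh (b / 2)
  have e1 : 1 - (s / c) ^ 2 = 1 / c ^ 2 := by field_simp; linarith
  have e2 : 1 - (S / C) ^ 2 = 1 / C ^ 2 := by field_simp; linarith
  rw [e1, e2]
  field_simp
  linear_combination (2 * s ^ 2) * hcb + (2 * S ^ 2) * hca

/-- The cosine of the largest angle between points at distances `ρ - t` and `ρ - u` from the
origin whose hyperbolic distance is at most `ρ`; a value below `-1` means that all angles are
allowed. -/
noncomputable def threshold (ρ t u : ℝ) : ℝ :=
  (Real.cosh (ρ - t) * Real.cosh (ρ - u) - Real.cosh ρ) / (Real.sinh (ρ - t) * Real.sinh (ρ - u))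

lemma one_sub_threshold {ρ t u : ℝ} (ht : t < ρ) (hu : u < ρ) :
    1 - threshold ρ t u =
      (Real.cosh ρ - Real.cosh (t - u)) / (Real.sinh (ρ - t) * Real.sinh (ρ - u)) := by
  have h1 : 0 < Real.sinh (ρ - t) := Real.sinh_pos_iff.2 (by linarith)
  have h2 : 0 < Real.sinh (ρ - u) := Real.sinh_pos_iff.2 (by linarith)
  have h3 : Real.cosh (t - u) = Real.cosh (ρ - u) * Real.cosh (ρ - t) -
      Real.sinh (ρ - u) * Real.sinh (ρ - t) := by
    rw [← Real.cosh_sub]; congr 1; ring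
  rw [threshold, h3]
  field_simp
  ring

lemma threshold_le_one {ρ t u : ℝ} (ht0 : 0 ≤ t) (ht : t < ρ) (hu0 : 0 ≤ u) (hu : u < ρ) :
    threshold ρ t u ≤ 1 := by
  have h1 : 0 < Real.sinh (ρ - t) := Real.sinh_pos_iff.2 (by linarith)
  have h2 : 0 < Real.sinh (ρ - u) := Real.sinh_pos_iff.2 (by linarith)
  have h3 : Real.cosh (t - u) ≤ Real.cosh ρ := by
    rw [Real.cosh_le_cosh, abs_le, abs_of_pos (by linarith : 0 < ρ)]
    constructor <;> linarith
  have := one_sub_threshold ht hu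
  have : 0 ≤ 1 - threshold ρ t u := by
    rw [this]
    exact div_nonneg (by linarith) (by positivity)
  linarith

lemma R_pos {d n : ℕ} (hd : 2 ≤ d) (hn : 2 ≤ n) : 0 < R d n := by
  have h1 : (2 : ℝ) ≤ d := by exact_mod_cast hd
  have h2 : (1 : ℝ) < n := by exact_mod_cast hn
  have := Real.log_pos h2
  have : 0 < (d : ℝ) - 1 := by linarith
  unfold R; positivity

lemma norm_point_lt_one {d : ℕ} (hd : 2 ≤ d) (n : ℕ) (t : ℝ) (θ : Fin (d - 1) → ℝ) :
    ‖point d n t θ‖ < 1 := by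
  rw [point, norm_smul, norm_direction hd, mul_one, Real.norm_eq_abs, abs_lt]
  exact ⟨Real.neg_one_lt_tanh _, Real.tanh_lt_one _⟩

/-- The hyperbolic ball of radius `R_n` around `p`, in terms of `coshDist`. -/
def hypBall (d n : ℕ) (p : E d) : Set (E d) :=
  {y | ‖y‖ < 1 ∧ coshDist y p ≤ Real.cosh (R d n)}

lemma measurableSet_hypBall (d n : ℕ) (p : E d) : MeasurableSet (hypBall d n p) := by
  have h : Measurable fun y => coshDist y p := by unfold coshDist; fun_prop
  exact (measurableSet_lt measurable_norm measurable_const).inter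
    (measurableSet_le h measurable_const)

lemma point_mem_hypBall_iff {d n : ℕ} (hd : 2 ≤ d) {t u : ℝ} (ht : t < R d n) (hu : u < R d n)
    (θ' θ : Fin (d - 1) → ℝ) :
    point d n t θ' ∈ hypBall d n (point d n u θ) ↔
      threshold (R d n) t u ≤ inner ℝ (direction d θ') (direction d θ) := by
  have h1 : 0 < Real.sinh (R d n - t) := Real.sinh_pos_iff.2 (by linarith)
  have h2 : 0 < Real.sinh (R d n - u) := Real.sinh_pos_iff.2 (by linarith)
  change ‖point d n t θ'‖ < 1 ∧ coshDist (point d n t θ') (point d n u θ) ≤ _ ↔ _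
  rw [point, point, coshDist_polar (norm_direction hd θ') (norm_direction hd θ), threshold,
    div_le_iff₀ (by positivity)]
  constructor
  · rintro ⟨-, h⟩; linarith
  · intro h; exact ⟨norm_point_lt_one hd n t θ', by linarith⟩

lemma integral_sinh_pos {ρ α : ℝ} (hρ : 0 < ρ) (hα : 0 < α) (k : ℕ) :
    0 < ∫ x in (0 : ℝ)..ρ, Real.sinh (α * x) ^ k :=
  intervalIntegral.intervalIntegral_pos_of_pos_on
    ((by fun_prop : Continuous fun x => Real.sinh (α * x) ^ k).intervalIntegrable _ _)
    (fun x hx => pow_pos (Real.sinh_pos_iff.2 (mul_pos hα hx.1)) k) hρ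

lemma continuous_radialDensity (d n : ℕ) (α : ℝ) : Continuous (radialDensity d n α) := by
  unfold radialDensity
  exact Continuous.div_const (by fun_prop) _

lemma radialDensity_nonneg {d n : ℕ} {α t : ℝ} (hd : 2 ≤ d) (hn : 2 ≤ n) (hα : 0 < α)
    (ht : t ≤ R d n) : 0 ≤ radialDensity d n α t :=
  div_nonneg (pow_nonneg (Real.sinh_nonneg_iff.2 (mul_nonneg hα.le (by linarith))) _)
    (integral_sinh_pos (R_pos hd hn) hα _).le

/-- Integration of a bounded continuous function against the radial law. -/
lemma lintegral_radialLaw {d n : ℕ} {α : ℝ} (hd : 2 ≤ d) (hn : 2 ≤ n) (hα : 0 < α)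
    {g : ℝ → ℝ} (hg : Measurable g) (hg0 : ∀ t, 0 ≤ g t) (hg1 : ∀ t, g t ≤ 1) :
    ∫⁻ t, ENNReal.ofReal (g t) ∂(radialLaw d n α) =
      ENNReal.ofReal (∫ t in (0 : ℝ)..R d n, radialDensity d n α t * g t) := by
  have hR := R_pos hd hn
  have hc := continuous_radialDensity d n α
  rw [radialLaw, lintegral_withDensity_eq_lintegral_mul _ hc.measurable.ennreal_ofReal
    hg.ennreal_ofReal, intervalIntegral.integral_of_le hR.le, ← integral_Icc_eq_integral_Ioc,
    ofReal_integral_eq_lintegral_ofReal]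
  · refine setLIntegral_congr_fun measurableSet_Icc fun t ht => ?_
    simp only [Pi.mul_apply]
    rw [ENNReal.ofReal_mul (radialDensity_nonneg hd hn hα ht.2)]
  · refine (hc.continuousOn.integrableOn_Icc).mul_bdd (c := 1) hg.aestronglyMeasurable
      (Eventually.of_forall fun t => ?_)
    rw [Real.norm_eq_abs, abs_of_nonneg (hg0 t)]
    exact hg1 t
  · refine (ae_restrict_iff' measurableSet_Icc).2 (Eventually.of_forall fun t ht => ?_)
    exact mul_nonneg (radialDensity_nonneg hd hn hα ht.2) (hg0 t)

lemma isProbabilityMeasure_radialLaw {d n : ℕ} {α : ℝ} (hd : 2 ≤ d) (hn : 2 ≤ n) (hα : 0 < α) :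
    IsProbabilityMeasure (radialLaw d n α) := by
  refine ⟨?_⟩
  have h := lintegral_radialLaw hd hn hα (g := fun _ => 1) measurable_const
    (fun _ => zero_le_one) (fun _ => le_rfl)
  have hI := integral_sinh_pos (R_pos hd hn) hα (d - 1)
  have h2 : ∫ t in (0 : ℝ)..R d n, Real.sinh (α * (R d n - t)) ^ (d - 1) =
      ∫ x in (0 : ℝ)..R d n, Real.sinh (α * x) ^ (d - 1) := by
    simpa using intervalIntegral.integral_comp_sub_left (a := 0) (b := R d n)
      (fun x => Real.sinh (α * x) ^ (d - 1)) (R d n)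
  simp only [radialDensity, mul_one, intervalIntegral.integral_div] at h
  rw [h2, div_self hI.ne'] at h
  simpa using h

lemma measurable_point {d : ℕ} (hd : 2 ≤ d) (n : ℕ) :
    Measurable fun x : ℝ × (Fin (d - 1) → ℝ) => point d n x.1 x.2 := by
  have h1 := measurable_direction hd
  have h2 : Measurable Real.tanh := by
    have : Real.tanh = fun x => Real.sinh x / Real.cosh x := by
      ext x; exact Real.tanh_eq_sinh_div_cosh x
    rw [this]; fun_prop
  unfold point
  fun_prop

lemma isProbabilityMeasure_vertexLaw {d n : ℕ} {α : ℝ} (hd : 2 ≤ d) (hn : 2 ≤ n) (hα : 0 < α) :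
    IsProbabilityMeasure (vertexLaw d n α) := by
  have := isProbabilityMeasure_radialLaw hd hn hα
  have := isProbabilityMeasure_angularLaw hd
  exact Measure.isProbabilityMeasure_map (measurable_point hd n).aemeasurable

/-- The probability that a vertex is within hyperbolic distance `R_n` of a point of depth `u`. -/
noncomputable def connProb (d n : ℕ) (α u : ℝ) : ℝ :=
  ∫ t in (0 : ℝ)..R d n, radialDensity d n α t * capProb d (threshold (R d n) t u)

lemma radialLaw_absolutelyContinuous (d n : ℕ) (α : ℝ) :
    radialLaw d n α ≪ volume.restrict (Set.Icc 0 (R d n)) := withDensity_absolutelyContinuous _ _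

lemma measurable_threshold (ρ u : ℝ) : Measurable fun t => threshold ρ t u := by
  unfold threshold; fun_prop

/-- The ball around `p` is a cap in each sphere around the origin, which gives the vertex law of
the ball after integration over the depth. -/
lemma vertexLaw_hypBall {d n : ℕ} {α u : ℝ} (hd : 2 ≤ d) (hn : 2 ≤ n) (hα : 0 < α)
    (hu : u ∈ Set.Ioo 0 (R d n)) (θ : Fin (d - 1) → ℝ) :
    vertexLaw d n α (hypBall d n (point d n u θ)) = ENNReal.ofReal (connProb d n α u) := by
  have := isProbabilityMeasure_radialLaw hd hn hα
  have := isProbabilityMeasure_angularLaw hd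
  have hA := measurableSet_hypBall d n (point d n u θ)
  rw [vertexLaw, Measure.map_apply (measurable_point hd n) hA,
    Measure.prod_apply (measurable_point hd n hA), connProb,
    ← lintegral_radialLaw hd hn hα (g := fun t => capProb d (threshold (R d n) t u))
      ((continuous_capProb d).measurable.comp (measurable_threshold _ _))
      (fun t => capProb_nonneg d _) (fun t => capProb_le_one d _)]
  refine lintegral_congr_ae ?_
  refine (radialLaw_absolutelyContinuous d n α).ae_le ?_
  rw [← restrict_Ico_eq_restrict_Icc]
  refine (ae_restrict_iff' measurableSet_Ico).2 (Eventually.of_forall fun t ht => ?_)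
  change angularLaw d {θ' | point d n t θ' ∈ hypBall d n (point d n u θ)} = _
  simp only [point_mem_hypBall_iff hd ht.2 hu.2]
  exact angularLaw_cap hd (norm_direction hd θ)
    (threshold_le_one ht.1 ht.2 hu.1.le hu.2)

lemma connProb_nonneg {d n : ℕ} {α u : ℝ} (hd : 2 ≤ d) (hn : 2 ≤ n) (hα : 0 < α) :
    0 ≤ connProb d n α u :=
  intervalIntegral.integral_nonneg (R_pos hd hn).le fun _ ht =>
    mul_nonneg (radialDensity_nonneg hd hn hα ht.2) (capProb_nonneg d _)

lemma ae_vertexLaw_norm_lt_one {d : ℕ} (hd : 2 ≤ d) (n : ℕ) (α : ℝ) :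
    ∀ᵐ y ∂(vertexLaw d n α), ‖y‖ < 1 := by
  rw [vertexLaw, ae_map_iff (measurable_point hd n).aemeasurable
    (measurableSet_lt measurable_norm measurable_const)]
  exact Eventually.of_forall fun x => norm_point_lt_one hd n x.1 x.2

/-- The vertex law has no atoms, since its radial part has none. -/
lemma vertexLaw_singleton {d n : ℕ} {α : ℝ} (hd : 2 ≤ d) (hn : 2 ≤ n) (hα : 0 < α) (y : E d) :
    vertexLaw d n α {y} = 0 := by
  have := isProbabilityMeasure_radialLaw hd hn hα
  have := isProbabilityMeasure_angularLaw hd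
  rw [vertexLaw, Measure.map_apply (measurable_point hd n) (measurableSet_singleton y),
    Measure.prod_apply (measurable_point hd n (measurableSet_singleton y)),
    lintegral_eq_zero_iff (measurable_measure_prodMk_left
      (measurable_point hd n (measurableSet_singleton y)))]
  refine (radialLaw_absolutelyContinuous d n α).ae_le ?_
  -- only one radius in `[0, R_n]` is compatible with the point `y`
  have hfin : {t ∈ Set.Icc 0 (R d n) | Real.tanh ((R d n - t) / 2) = ‖y‖}.Subsingleton := by
    rintro a ⟨-, ha⟩ b ⟨-, hb⟩
    have := Real.tanh_injective (ha.trans hb.symm)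
    linarith
  have h0 : ∀ᵐ t : ℝ, t ∉ {t ∈ Set.Icc 0 (R d n) | Real.tanh ((R d n - t) / 2) = ‖y‖} :=
    measure_eq_zero_iff_ae_notMem.1 (hfin.measure_zero _)
  refine (ae_restrict_iff' measurableSet_Icc).2 (h0.mono fun t ht htm => ?_)
  have hempty : (Prod.mk t ⁻¹' ((fun x : ℝ × (Fin (d - 1) → ℝ) => point d n x.1 x.2) ⁻¹' {y})) =
      ∅ := by
    refine Set.eq_empty_of_forall_notMem fun θ hθ => ht ⟨htm, ?_⟩
    have hθ : point d n t θ = y := hθ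
    have h2 : 0 ≤ Real.tanh ((R d n - t) / 2) := by
      rw [Real.tanh_eq_sinh_div_cosh]
      exact div_nonneg (Real.sinh_nonneg_iff.2 (by linarith [htm.2])) (Real.cosh_pos _).le
    rw [← hθ, point, norm_smul, norm_direction hd, mul_one, Real.norm_eq_abs, abs_of_nonneg h2]
  exact (congrArg (angularLaw d) hempty).trans measure_empty

/-! ### Factorial moments of a Poisson sample -/

/-- The `r`-th factorial moment of the Poisson distribution. -/
lemma hasSum_poisson_descFactorial (a : NNReal) (r : ℕ) :
    HasSum (fun m : ℕ => Real.exp (-a) * (a : ℝ) ^ m / (m.factorial : ℝ) * m.descFactorial r)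
      ((a : ℝ) ^ r) := by
  rw [← hasSum_nat_add_iff' r]
  have h0 : ∑ i ∈ Finset.range r, Real.exp (-a) * (a : ℝ) ^ i / (i.factorial : ℝ) *
      i.descFactorial r = 0 := by
    refine Finset.sum_eq_zero fun i hi => ?_
    rw [Nat.descFactorial_of_lt (Finset.mem_range.1 hi)]
    simp
  rw [h0, sub_zero]
  have h1 := (ProbabilityTheory.hasSum_one_poissonMeasure a).mul_left ((a : ℝ) ^ r)
  rw [mul_one] at h1
  refine (congrArg (HasSum · _) (funext fun j => ?_)).mp h1
  have h2 : ((j + r).factorial : ℝ) = j.factorial * (j + r).descFactorial r := by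
    rw [← Nat.factorial_mul_descFactorial (Nat.le_add_left r j), Nat.add_sub_cancel]
    push_cast
    ring
  have h3 : (j.factorial : ℝ) ≠ 0 := by exact_mod_cast j.factorial_ne_zero
  have h4 : ((j + r).descFactorial r : ℝ) ≠ 0 := by
    intro h
    rw [h, mul_zero] at h2
    exact (j + r).factorial_ne_zero (by exact_mod_cast h2)
  rw [h2, pow_add]
  field_simp

/-- The number of injective choices of `r` of the `m` points in `A`. -/
noncomputable def tupleCount {X : Type*} (r : ℕ) (A : Set X) {m : ℕ} (x : Fin m → X) : ENNReal :=
  ∑ f : Fin r ↪ Fin m, ∏ i, A.indicator 1 (x (f i))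

lemma measurable_tupleCount {X : Type*} [MeasurableSpace X] (r : ℕ) {A : Set X}
    (hA : MeasurableSet A) {m : ℕ} : Measurable fun x : Fin m → X => tupleCount r A x :=
  Finset.measurable_sum _ fun f _ => Finset.measurable_prod _ fun i _ =>
    (measurable_one.indicator hA).comp (measurable_pi_apply (f i))

/-- Each of the `m (m - 1) ⋯ (m - r + 1)` injective choices of indices contributes `ν A ^ r`. -/
lemma lintegral_tupleCount {X : Type*} [MeasurableSpace X] (ν : Measure X)
    [IsProbabilityMeasure ν] (r : ℕ) {A : Set X} (hA : MeasurableSet A) (m : ℕ) :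
    ∫⁻ x, tupleCount r A x ∂(Measure.pi fun _ : Fin m => ν) = m.descFactorial r * ν A ^ r := by
  classical
  unfold tupleCount
  have hm : ∀ f : Fin r ↪ Fin m,
      Measurable fun x : Fin m → X => ∏ i, A.indicator (1 : X → ENNReal) (x (f i)) := fun f =>
    Finset.measurable_prod _ fun i _ =>
      (measurable_one.indicator hA).comp (measurable_pi_apply (f i))
  rw [lintegral_finsetSum _ fun f _ => hm f]
  have h : ∀ f : Fin r ↪ Fin m, ∫⁻ x : Fin m → X, ∏ i, A.indicator 1 (x (f i))
      ∂(Measure.pi fun _ : Fin m => ν) = ν A ^ r := by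
    intro f
    set S : Fin m → Set X := fun j => if j ∈ Finset.univ.map f then A else Set.univ with hS
    have hSm : MeasurableSet (Set.univ.pi S) := by
      refine MeasurableSet.univ_pi fun j => ?_
      simp only [hS]
      split_ifs
      · exact hA
      · exact MeasurableSet.univ
    have h1 : ∀ x : Fin m → X, ∏ i, A.indicator (1 : X → ENNReal) (x (f i)) =
        (Set.univ.pi S).indicator 1 x := by
      intro x
      by_cases hx : ∀ i, x (f i) ∈ A
      · rw [Set.indicator_of_mem, Finset.prod_eq_one fun i _ => Set.indicator_of_mem (hx i) _]
        · rfl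
        · intro j _
          simp only [hS, Finset.mem_map, Finset.mem_univ, true_and]
          split_ifs with hj
          · obtain ⟨i, rfl⟩ := hj; exact hx i
          · trivial
      · obtain ⟨i, hi⟩ := not_forall.1 hx
        rw [Set.indicator_of_notMem, Finset.prod_eq_zero (Finset.mem_univ i)
          (Set.indicator_of_notMem hi _)]
        intro H
        have := H (f i) trivial
        simp only [hS, Finset.mem_map, Finset.mem_univ, true_and] at this
        rw [if_pos ⟨i, rfl⟩] at this
        exact hi this
    simp only [h1]
    rw [lintegral_indicator_one hSm, Measure.pi_pi]
    have h2 : ∀ j, ν (S j) = if j ∈ Finset.univ.map f then ν A else 1 := by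
      intro j
      simp only [hS]
      split_ifs
      · rfl
      · exact measure_univ
    simp only [h2]
    rw [Finset.prod_ite_mem, Finset.univ_inter, Finset.prod_const, Finset.card_map,
      Finset.card_univ, Fintype.card_fin]
  simp only [h]
  rw [Finset.sum_const, Finset.card_univ, Fintype.card_embedding_eq, nsmul_eq_mul]
  simp

/-- Independent samples of a law without atoms are pairwise distinct. -/
lemma ae_injective_pi {X : Type*} [MeasurableSpace X] [MeasurableEq X] (ν : Measure X)
    [IsProbabilityMeasure ν] (hν : ∀ y, ν {y} = 0) (m : ℕ) :
    ∀ᵐ x ∂(Measure.pi fun _ : Fin m => ν), Function.Injective x := by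
  have hdiag : (ν.prod ν) {p : X × X | p.1 = p.2} = 0 := by
    have hm : MeasurableSet {p : X × X | p.1 = p.2} :=
      measurableSet_eq_fun measurable_fst measurable_snd
    rw [Measure.prod_apply hm, lintegral_eq_zero_iff (measurable_measure_prodMk_left hm)]
    refine Eventually.of_forall fun y => ?_
    have : Prod.mk y ⁻¹' {p : X × X | p.1 = p.2} = {y} := by
      ext z; exact eq_comm
    exact (congrArg ν this).trans (hν y)
  have h : ∀ i j : Fin m, i ≠ j → ∀ᵐ x ∂(Measure.pi fun _ : Fin m => ν), x i ≠ x j := by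
    intro i j hij
    have hind := (ProbabilityTheory.iIndepFun_pi (μ := fun _ : Fin m => ν)
      (X := fun _ => id) fun _ => aemeasurable_id).indepFun hij
    have hmap := (ProbabilityTheory.indepFun_iff_map_prod_eq_prod_map_map
      (measurable_pi_apply i).aemeasurable (measurable_pi_apply j).aemeasurable).1 hind
    have e : ∀ i, Measure.map (fun x : Fin m → X => x i) (Measure.pi fun _ : Fin m => ν) = ν :=
      fun i => (measurePreserving_eval (fun _ : Fin m => ν) i).map_eq
    have hmap' : Measure.map (fun x : Fin m → X => (x i, x j)) (Measure.pi fun _ : Fin m => ν) =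
        ν.prod ν := by
      refine hmap.trans ?_
      exact congrArg₂ Measure.prod (e i) (e j)
    rw [← hmap', Measure.map_apply (by fun_prop)
      (measurableSet_eq_fun measurable_fst measurable_snd)] at hdiag
    exact measure_eq_zero_iff_ae_notMem.1 hdiag
  have h2 : ∀ᵐ x ∂(Measure.pi fun _ : Fin m => ν), ∀ i j : Fin m, i ≠ j → x i ≠ x j := by
    refine ae_all_iff.2 fun i => ae_all_iff.2 fun j => ?_
    by_cases hij : i = j
    · exact Eventually.of_forall fun x hne => absurd hij hne
    · exact (h i j hij).mono fun x hx _ => hx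
  refine h2.mono fun x hx i j hij => ?_
  by_contra hne
  exact hx i j hne hij

/-- For distinct points in the ball, the star count is the number of injective choices of
indices. -/
lemma starCount_eq_tupleCount {d k n m : ℕ} {p : E d} (hp : ‖p‖ < 1) (hR : 0 ≤ R d n)
    {x : Fin m → E d} (hx : Function.Injective x) (hx1 : ∀ i, ‖x i‖ < 1) :
    (starCount d k n (Set.range x) p : ENNReal) = tupleCount (k - 1) (hypBall d n p) x := by
  classical
  have hiff : ∀ i, hypDist (x i) p ≤ R d n ↔ x i ∈ hypBall d n p := fun i =>
    (hypDist_le_iff (hx1 i) hp hR).trans ⟨fun h => ⟨hx1 i, h⟩, fun h => h.2⟩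
  set T : Finset (Fin (k - 1) ↪ Fin m) :=
    Finset.univ.filter fun f => ∀ i, x (f i) ∈ hypBall d n p with hT
  have hset : {Y : Fin (k - 1) → E d | (∀ i, Y i ∈ Set.range x) ∧ Function.Injective Y ∧
      ∀ i, hypDist (Y i) p ≤ R d n} =
      (fun f : Fin (k - 1) ↪ Fin m => fun i => x (f i)) '' (T : Set (Fin (k - 1) ↪ Fin m)) := by
    ext Y
    constructor
    · rintro ⟨h1, h2, h3⟩
      choose g hg using h1
      have hginj : Function.Injective g := fun a b hab => h2 (by rw [← hg a, ← hg b, hab])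
      refine ⟨⟨g, hginj⟩, ?_, funext hg⟩
      simp only [hT, Finset.coe_filter, Finset.mem_univ, true_and]
      intro i
      change x (g i) ∈ _
      rw [← hiff, hg]
      exact h3 i
    · rintro ⟨f, hf, rfl⟩
      have hf : ∀ i, x (f i) ∈ hypBall d n p := (Finset.mem_filter.1 hf).2
      exact ⟨fun i => ⟨f i, rfl⟩, hx.comp f.injective, fun i => (hiff _).2 (hf i)⟩
  have hinj : Function.Injective (fun f : Fin (k - 1) ↪ Fin m => fun i => x (f i)) := by
    intro f g hfg
    ext i
    exact congrArg Fin.val (hx (congrFun hfg i))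
  rw [starCount, hset, Set.ncard_image_of_injective _ hinj, Set.ncard_coe_finset, tupleCount, hT,
    Finset.card_filter]
  push_cast
  refine Finset.sum_congr rfl fun f _ => ?_
  split_ifs with h
  · rw [Finset.prod_eq_one fun i _ => Set.indicator_of_mem (h i) _]
  · obtain ⟨i, hi⟩ := not_forall.1 h
    rw [Finset.prod_eq_zero (Finset.mem_univ i) (Set.indicator_of_notMem hi _)]

/-- The star counts are a.s. equal to the count of injective tuples, so that they are integrable,
with the `(k-1)`-st factorial moment of a Poisson variable as expectation. -/
theorem integrable_D_and_mu_eq {d k n : ℕ} {α u : ℝ} (hd : 2 ≤ d) (hn : 2 ≤ n) (hα : 0 < α)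
    (hu : u ∈ Set.Ioo 0 (R d n)) (θ : Fin (d - 1) → ℝ) :
    Integrable (D d k n u θ) (vertexSample d n α) ∧
      mu d k n α u θ = (n * connProb d n α u) ^ (k - 1) := by
  have hprob := isProbabilityMeasure_vertexLaw hd hn hα
  set p := point d n u θ with hp
  set A := hypBall d n p with hAdef
  have hA : MeasurableSet A := measurableSet_hypBall d n p
  set ν := vertexLaw d n α with hν
  set r := k - 1 with hr
  have hq0 : 0 ≤ connProb d n α u := connProb_nonneg hd hn hα
  set T : (Σ m : ℕ, Fin m → E d) → ENNReal := fun x => tupleCount r A x.2 with hT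
  have hmk : ∀ m : ℕ, Measurable (Sigma.mk (β := fun m : ℕ => Fin m → E d) m) :=
    fun m s hs => MeasurableSpace.measurableSet_iInf.1 hs m
  have hTm : Measurable T := fun s hs => MeasurableSpace.measurableSet_iInf.2 fun m =>
    measurable_tupleCount (m := m) r hA hs
  have hae : (fun x => D d k n u θ x) =ᵐ[vertexSample d n α] fun x => (T x).toReal := by
    rw [vertexSample, Filter.EventuallyEq, Measure.ae_sum_iff]
    intro m
    refine Measure.ae_smul_measure ?_ _
    have h1 : ∀ᵐ x ∂(Measure.pi fun _ : Fin m => ν), ∀ i, ‖x i‖ < 1 :=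
      ae_all_iff.2 fun i => (Measure.quasiMeasurePreserving_eval (fun _ : Fin m => ν) i).ae
        (ae_vertexLaw_norm_lt_one hd n α)
    have h2 := ae_injective_pi ν (vertexLaw_singleton hd hn hα) m
    have hemb : MeasurableEmbedding (Sigma.mk (β := fun m : ℕ => Fin m → E d) m) := by
      refine ⟨sigma_mk_injective, hmk m, fun s hs => ?_⟩
      refine MeasurableSpace.measurableSet_iInf.2 fun j => ?_
      change MeasurableSet (Sigma.mk (β := fun m : ℕ => Fin m → E d) j ⁻¹'
        (Sigma.mk (β := fun m : ℕ => Fin m → E d) m '' s))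
      by_cases hj : j = m
      · subst hj
        rwa [Set.preimage_image_eq _ sigma_mk_injective]
      · have : Sigma.mk (β := fun m : ℕ => Fin m → E d) j ⁻¹'
            (Sigma.mk (β := fun m : ℕ => Fin m → E d) m '' s) = ∅ := by
          refine Set.eq_empty_of_forall_notMem ?_
          rintro y ⟨z, -, hz⟩
          exact hj (congrArg Sigma.fst hz).symm
        rw [this]
        exact MeasurableSet.empty
    rw [hemb.ae_map_iff]
    filter_upwards [h1, h2] with x hx1 hx2
    have h3 := starCount_eq_tupleCount (k := k) (norm_point_lt_one hd n u θ)
      (R_pos hd hn).le hx2 hx1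
    change ((starCount d k n (Set.range x) p : ℕ) : ℝ) = (tupleCount r A x).toReal
    rw [← h3, ENNReal.toReal_natCast]
  have hlint : ∫⁻ x, T x ∂(vertexSample d n α) =
      ENNReal.ofReal ((n * connProb d n α u) ^ r) := by
    rw [vertexSample, lintegral_sum_measure]
    have h1 : ∀ m : ℕ, ∫⁻ x, T x ∂(ProbabilityTheory.poissonMeasure (n : NNReal) {m} •
        (Measure.pi fun _ : Fin m => ν).map (Sigma.mk m)) =
        ENNReal.ofReal (Real.exp (-(n : NNReal)) * ((n : NNReal) : ℝ) ^ m / (m.factorial : ℝ) *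
          m.descFactorial r) * ENNReal.ofReal (connProb d n α u) ^ r := by
      intro m
      rw [lintegral_smul_measure, lintegral_map hTm (hmk m)]
      change _ • ∫⁻ x, tupleCount r A x ∂(Measure.pi fun _ : Fin m => ν) = _
      rw [lintegral_tupleCount ν r hA, vertexLaw_hypBall hd hn hα hu,
        ProbabilityTheory.poissonMeasure_singleton, smul_eq_mul,
        ENNReal.ofReal_mul (by positivity), ENNReal.ofReal_natCast, mul_assoc]
    rw [tsum_congr h1]
    have hs := hasSum_poisson_descFactorial (n : NNReal) r
    rw [ENNReal.tsum_mul_right, ← ENNReal.ofReal_tsum_of_nonneg (fun m => by positivity)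
      hs.summable, hs.tsum_eq, ← ENNReal.ofReal_pow hq0, ← ENNReal.ofReal_mul (by positivity),
      mul_pow]
    simp
  have hint : Integrable (fun x => (T x).toReal) (vertexSample d n α) :=
    integrable_toReal_of_lintegral_ne_top hTm.aemeasurable
      (by rw [hlint]; exact ENNReal.ofReal_ne_top)
  refine ⟨hint.congr hae.symm, ?_⟩
  rw [mu, integral_congr_ae hae, integral_toReal hTm.aemeasurable
    (ae_lt_top hTm (by rw [hlint]; exact ENNReal.ofReal_ne_top)), hlint,
    ENNReal.toReal_ofReal (by positivity)]

/-! ### Small spherical caps -/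

/-- The measure of a cap of height `1 - τ` is at most of the order `(1 - τ) ^ ((d - 1) / 2)`,
because its opening `φ` satisfies `1 - cos φ ≥ 2 φ² / π²` and `sin x ≤ φ` for `x ≤ φ`. -/
lemma capProb_le {d : ℕ} (hd : 2 ≤ d) {τ : ℝ} (hτ : τ ≤ 1) :
    capProb d τ ≤ (Real.pi * √(1 - τ)) ^ (d - 1) / kappa d := by
  have hφ0 := Real.arccos_nonneg τ
  have hφ1 := Real.arccos_le_pi τ
  have hpi := Real.pi_pos
  have h1 : τ ≤ Real.cos (Real.arccos τ) :=
    (le_cos_iff_le_arccos hτ ⟨hφ0, hφ1⟩).2 le_rfl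
  have h2 : Real.cos (Real.arccos τ) ≤ 1 - 2 / Real.pi ^ 2 * Real.arccos τ ^ 2 :=
    Real.cos_le_one_sub_mul_cos_sq (by rwa [abs_of_nonneg hφ0])
  set φ := Real.arccos τ with hφ
  have h3 : φ ≤ Real.pi * √(1 - τ) := by
    have h4 : 2 / Real.pi ^ 2 * φ ^ 2 ≤ 1 - τ := by linarith
    have h5 : φ ^ 2 ≤ Real.pi ^ 2 * (1 - τ) := by
      rw [div_mul_eq_mul_div, div_le_iff₀ (by positivity)] at h4
      nlinarith [sq_nonneg φ]
    calc φ = √(φ ^ 2) := (Real.sqrt_sq hφ0).symm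
      _ ≤ √(Real.pi ^ 2 * (1 - τ)) := Real.sqrt_le_sqrt h5
      _ = Real.pi * √(1 - τ) := by
        rw [Real.sqrt_mul (by positivity), Real.sqrt_sq hpi.le]
  have h6 : ∫ x in (0 : ℝ)..φ, Real.sin x ^ (d - 2) ≤ φ ^ (d - 1) := by
    have h7 : ∫ x in (0 : ℝ)..φ, Real.sin x ^ (d - 2) ≤ ∫ x in (0 : ℝ)..φ, φ ^ (d - 2) := by
      refine intervalIntegral.integral_mono_on hφ0
        ((by fun_prop : Continuous fun x => Real.sin x ^ (d - 2)).intervalIntegrable _ _)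
        (by simp) fun x hx => ?_
      have hs := Real.sin_nonneg_of_mem_Icc ⟨hx.1, hx.2.trans hφ1⟩
      exact pow_le_pow_left₀ hs ((Real.sin_le hx.1).trans hx.2) _
    rw [intervalIntegral.integral_const, sub_zero, smul_eq_mul, ← pow_succ'] at h7
    rwa [show d - 2 + 1 = d - 1 by omega] at h7
  rw [capProb]
  have := kappa_pos d
  gcongr
  exact h6.trans (pow_le_pow_left₀ hφ0 h3 _)

/-- Small caps have measure proportional to the `(d-1)`-st power of their radius. The scaling
`x = φ s` turns the cap integral into `φ ^ (m + 1)` times a function continuous in `φ`. -/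
lemma tendsto_capProb {d : ℕ} (hd : 2 ≤ d) :
    Tendsto (fun τ => capProb d τ / √(1 - τ) ^ (d - 1)) (𝓝[<] 1)
      (𝓝 (√2 ^ (d - 1) / (((d : ℝ) - 1) * kappa d))) := by
  obtain ⟨m, rfl⟩ := Nat.exists_eq_add_of_le' hd
  simp only [show m + 2 - 1 = m + 1 by omega]
  set h : ℝ → ℝ := fun φ => ∫ s in (0 : ℝ)..1, s ^ m * Real.sinc (φ * s) ^ m with hh
  have hcont : Continuous h := by
    have := Real.continuous_sinc
    exact intervalIntegral.continuous_parametric_intervalIntegral_of_continuous'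
      (by fun_prop) 0 1
  have hh0 : h 0 = 1 / (m + 1) := by
    simp only [hh, zero_mul, Real.sinc_zero, one_pow, mul_one, integral_pow]
    simp
  have hscale : ∀ φ, 0 < φ → ∫ x in (0 : ℝ)..φ, Real.sin x ^ m = φ ^ (m + 1) * h φ := by
    intro φ hφ
    have h1 := intervalIntegral.integral_comp_mul_left (a := 0) (b := 1)
      (fun x => Real.sin x ^ m) hφ.ne'
    rw [mul_zero, mul_one, smul_eq_mul] at h1
    have h2 : ∫ s in (0 : ℝ)..1, Real.sin (φ * s) ^ m = φ ^ m * h φ := by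
      rw [hh, ← intervalIntegral.integral_const_mul]
      refine intervalIntegral.integral_congr fun s _ => ?_
      rw [← mul_assoc, ← mul_pow, ← mul_pow]
      congr 1
      rcases eq_or_ne s 0 with rfl | hs
      · simp
      · rw [Real.sinc_of_ne_zero (by positivity)]
        field_simp
    rw [h2] at h1
    rw [pow_succ', mul_assoc, h1, mul_inv_cancel_left₀ hφ.ne']
  -- the limit in terms of the opening angle `φ = arccos τ`
  have harc : Tendsto Real.arccos (𝓝[<] 1) (𝓝 0) := by
    have := Real.continuous_arccos.tendsto 1
    rw [Real.arccos_one] at this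
    exact this.mono_left nhdsWithin_le_nhds
  have hlim : Tendsto (fun φ => h φ * (√2 / Real.sinc (φ / 2)) ^ (m + 1) / kappa (m + 2)) (𝓝 0)
      (𝓝 (√2 ^ (m + 1) / ((((m + 2 : ℕ) : ℝ) - 1) * kappa (m + 2)))) := by
    have hs : Continuous fun φ : ℝ => Real.sinc (φ / 2) := by
      have := Real.continuous_sinc
      fun_prop
    have h1 : Tendsto (fun φ : ℝ => Real.sinc (φ / 2)) (𝓝 0) (𝓝 1) := by
      have := hs.tendsto 0
      simpa using this
    have h2 := ((hcont.tendsto 0).mul (((tendsto_const_nhds (x := √2)).div h1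
      one_ne_zero).pow (m + 1))).div_const (kappa (m + 2))
    rw [hh0] at h2
    have hk := (kappa_pos (m + 2)).ne'
    have e : 1 / ((m : ℝ) + 1) * (√2 / 1) ^ (m + 1) / kappa (m + 2) =
        √2 ^ (m + 1) / ((((m + 2 : ℕ) : ℝ) - 1) * kappa (m + 2)) := by
      push_cast
      rw [div_one, show (m : ℝ) + 2 - 1 = m + 1 by ring]
      field_simp
    rwa [e] at h2
  refine (hlim.comp harc).congr' ?_
  have hev : ∀ᶠ τ : ℝ in 𝓝[<] 1, τ ∈ Set.Ioo (0 : ℝ) 1 := Ioo_mem_nhdsLT zero_lt_one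
  filter_upwards [hev] with τ hτ
  have hφ0 : 0 < Real.arccos τ := Real.arccos_pos.2 hτ.2
  have hφ1 := Real.arccos_le_pi τ
  have hcos : Real.cos (Real.arccos τ) = τ := Real.cos_arccos (by linarith [hτ.1]) hτ.2.le
  simp only [Function.comp]
  set φ := Real.arccos τ with hφ
  have hsin : 0 < Real.sin (φ / 2) :=
    Real.sin_pos_of_pos_of_lt_pi (by linarith) (by linarith [Real.pi_pos])
  have h3 : 1 - τ = 2 * Real.sin (φ / 2) ^ 2 := by
    rw [← hcos, Real.sin_sq, Real.cos_sq, show 2 * (φ / 2) = φ by ring]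
    ring
  have h4 : √(1 - τ) = √2 * Real.sin (φ / 2) := by
    rw [h3, Real.sqrt_mul zero_le_two, Real.sqrt_sq hsin.le]
  have h2 : √2 ≠ 0 := by positivity
  have h22 : √2 ^ 2 = 2 := Real.sq_sqrt zero_le_two
  rw [capProb, h4, ← hφ, Nat.add_sub_cancel, hscale φ hφ0, Real.sinc_of_ne_zero (by positivity),
    div_right_comm]
  congr 1
  rw [mul_comm, mul_div_right_comm, ← div_pow]
  congr 2
  field_simp
  rw [h22]

/-! ### The threshold -/

lemma one_sub_threshold_le {ρ t u : ℝ} (ht : 1 ≤ ρ - t) (hu : 1 ≤ ρ - u) (hρ : 0 ≤ ρ) :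
    1 - threshold ρ t u ≤ 16 * Real.exp (-(ρ - t - u)) := by
  have hs : ∀ x : ℝ, 1 ≤ x → Real.exp x / 4 ≤ Real.sinh x := by
    intro x hx
    rw [Real.sinh_eq]
    have h1 : 1 + x ≤ Real.exp x := by linarith [Real.add_one_le_exp x]
    have h2 : Real.exp (-x) ≤ 1 / 2 := by
      rw [Real.exp_neg, inv_eq_one_div]
      exact one_div_le_one_div_of_le two_pos (by linarith)
    linarith
  rw [one_sub_threshold (by linarith) (by linarith)]
  have h1 := hs _ ht
  have h2 := hs _ hu
  have h3 : Real.cosh ρ ≤ Real.exp ρ := by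
    rw [Real.cosh_eq]
    have : Real.exp (-ρ) ≤ Real.exp ρ := Real.exp_le_exp.2 (by linarith)
    linarith
  have h4 := Real.cosh_pos (t - u)
  have hp1 := Real.exp_pos (ρ - t)
  have hp2 := Real.exp_pos (ρ - u)
  calc _ ≤ Real.exp ρ / (Real.exp (ρ - t) / 4 * (Real.exp (ρ - u) / 4)) := by
        gcongr
        linarith
    _ = 16 * Real.exp (-(ρ - t - u)) := by
        rw [show Real.exp ρ / (Real.exp (ρ - t) / 4 * (Real.exp (ρ - u) / 4)) =
          16 * (Real.exp ρ / (Real.exp (ρ - t) * Real.exp (ρ - u))) by field_simp; norm_num,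
          ← Real.exp_add, ← Real.exp_sub]
        congr 2
        ring

/-- Extracting the leading exponentials from `1 - threshold ρ t u`: the right-hand side tends to `2`
when `ρ`, `ρ - t` and `ρ - u` are large. -/
lemma one_sub_threshold_mul_exp {ρ t u : ℝ} (ht : t < ρ) (hu : u < ρ) :
    (1 - threshold ρ t u) * Real.exp (ρ - t - u) =
      2 * (1 + Real.exp (-(2 * ρ)) - Real.exp (-(ρ - t + u)) - Real.exp (-(ρ - u + t))) /
        ((1 - Real.exp (-(2 * (ρ - t)))) * (1 - Real.exp (-(2 * (ρ - u))))) := by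
  have hs : ∀ x : ℝ, Real.sinh x = Real.exp x / 2 * (1 - Real.exp (-(2 * x))) := by
    intro x
    rw [Real.sinh_eq, mul_sub, mul_one, div_mul_eq_mul_div, ← Real.exp_add]
    rw [show x + -(2 * x) = -x by ring]
    ring
  have hc : Real.cosh ρ - Real.cosh (t - u) = Real.exp ρ / 2 *
      (1 + Real.exp (-(2 * ρ)) - Real.exp (-(ρ - t + u)) - Real.exp (-(ρ - u + t))) := by
    rw [Real.cosh_eq, Real.cosh_eq, mul_sub, mul_sub, mul_add, mul_one, div_mul_eq_mul_div,
      div_mul_eq_mul_div, div_mul_eq_mul_div, ← Real.exp_add, ← Real.exp_add, ← Real.exp_add]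
    rw [show ρ + -(2 * ρ) = -ρ by ring, show ρ + -(ρ - t + u) = t - u by ring,
      show ρ + -(ρ - u + t) = -(t - u) by ring]
    ring
  have hpos : ∀ x : ℝ, 0 < x → 1 - Real.exp (-(2 * x)) ≠ 0 := by
    intro x hx
    have : Real.exp (-(2 * x)) < 1 := Real.exp_lt_one_iff.2 (by linarith)
    linarith
  have h1 := hpos (ρ - t) (by linarith)
  have h2 := hpos (ρ - u) (by linarith)
  have he : Real.exp ρ * Real.exp (ρ - t - u) = Real.exp (ρ - t) * Real.exp (ρ - u) := by
    rw [← Real.exp_add, ← Real.exp_add]; congr 1; ring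
  rw [one_sub_threshold ht hu, hs (ρ - t), hs (ρ - u), hc]
  have h3 := (Real.exp_pos (ρ - t)).ne'
  have h4 := (Real.exp_pos (ρ - u)).ne'
  rw [div_mul_eq_mul_div, div_eq_div_iff (by positivity) (by positivity)]
  linear_combination (1 / 2 * (1 + Real.exp (-(2 * ρ)) - Real.exp (-(ρ - t + u)) -
    Real.exp (-(ρ - u + t))) * ((1 - Real.exp (-(2 * (ρ - t)))) *
    (1 - Real.exp (-(2 * (ρ - u)))))) * he

/-! ### The expected number of neighbours -/

/-- The radial density `sinh^{d-1}(α (ρ - t))` on `t ≤ ρ`, scaled so as to converge when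
`ρ → ∞`. -/
noncomputable def scaledDensity (d : ℕ) (α ρ : ℝ) : ℝ → ℝ :=
  (Set.Iic ρ).indicator fun t => (Real.sinh (α * (ρ - t)) * Real.exp (-(α * ρ))) ^ (d - 1)

/-- The probability that points of depths `t` and `u` are adjacent, scaled by `n e^{-(d-1)u/2}` for
`n = e^{(d-1)ρ/2}`. -/
noncomputable def scaledCap (d : ℕ) (ρ u t : ℝ) : ℝ :=
  Real.exp (((d : ℝ) - 1) * (ρ - u) / 2) * capProb d (threshold ρ t u)

/-- The expected number of neighbours of a point of depth `u`, divided by `e^{(d-1)u/2}`. -/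
noncomputable def scaledDegree (d : ℕ) (α ρ u : ℝ) : ℝ :=
  (∫ t in Set.Ioi 0, scaledDensity d α ρ t * scaledCap d ρ u t) /
    ∫ t in Set.Ioi 0, scaledDensity d α ρ t

lemma natCast_sub_one_pos {d : ℕ} (hd : 2 ≤ d) : 0 < (d : ℝ) - 1 := by
  have : (2 : ℝ) ≤ d := by exact_mod_cast hd
  linarith

lemma exp_dim_mul_R {d n : ℕ} (hd : 2 ≤ d) (hn : 2 ≤ n) :
    Real.exp (((d : ℝ) - 1) * R d n / 2) = n := by
  have := natCast_sub_one_pos hd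
  have hn' : (0 : ℝ) < n := by exact_mod_cast (by omega : 0 < n)
  rw [R, show ((d : ℝ) - 1) * (2 / ((d : ℝ) - 1) * Real.log n) / 2 = Real.log n by field_simp,
    Real.exp_log hn']

/-- The expected degree as a quotient of integrals over `(0, ∞)`. The factor `n` equals
`e^{(d-1)ρ/2}` for `ρ = R_n`, and the scaling of the density cancels in the quotient. -/
lemma mul_connProb {d n : ℕ} {α u : ℝ} (hd : 2 ≤ d) (hn : 2 ≤ n) (hα : 0 < α) :
    n * connProb d n α u =
      Real.exp (((d : ℝ) - 1) * u / 2) * scaledDegree d α (R d n) u := by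
  have hR := R_pos hd hn
  set ρ := R d n with hρ
  set e := Real.exp (-(α * ρ)) with he
  have he0 : 0 < e := Real.exp_pos _
  set I := ∫ x in (0 : ℝ)..ρ, Real.sinh (α * x) ^ (d - 1) with hI
  have hI0 : 0 < I := integral_sinh_pos hR hα (d - 1)
  have hIoc : ∀ f : ℝ → ℝ,
      ∫ t in Set.Ioi 0, (Set.Iic ρ).indicator f t = ∫ t in (0 : ℝ)..ρ, f t := by
    intro f
    rw [setIntegral_indicator measurableSet_Iic, Set.Ioi_inter_Iic,
      intervalIntegral.integral_of_le hR.le]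
  have hden : ∫ t in Set.Ioi 0, scaledDensity d α ρ t = I * e ^ (d - 1) := by
    rw [scaledDensity, hIoc]
    simp only [mul_pow]
    rw [intervalIntegral.integral_mul_const]
    congr 1
    simpa using intervalIntegral.integral_comp_sub_left (a := 0) (b := ρ)
      (fun x => Real.sinh (α * x) ^ (d - 1)) ρ
  have hnum : ∫ t in Set.Ioi 0, scaledDensity d α ρ t * scaledCap d ρ u t =
      I * e ^ (d - 1) * (Real.exp (((d : ℝ) - 1) * (ρ - u) / 2) * connProb d n α u) := by
    have h1 : ∀ t, scaledDensity d α ρ t * scaledCap d ρ u t = (Set.Iic ρ).indicator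
        (fun t => (Real.sinh (α * (ρ - t)) * e) ^ (d - 1) * scaledCap d ρ u t) t := by
      intro t
      by_cases ht : t ∈ Set.Iic ρ
      · rw [scaledDensity, Set.indicator_of_mem ht, Set.indicator_of_mem ht]
      · rw [scaledDensity, Set.indicator_of_notMem ht, Set.indicator_of_notMem ht, zero_mul]
    simp only [h1]
    rw [hIoc, connProb, ← mul_assoc, ← intervalIntegral.integral_const_mul]
    refine intervalIntegral.integral_congr fun t _ => ?_
    simp only [radialDensity, scaledCap]
    rw [← hρ, ← hI]
    field_simp
    ring
  rw [scaledDegree, hnum, hden, mul_div_cancel_left₀ _ (by positivity), ← mul_assoc,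
    ← Real.exp_add, ← exp_dim_mul_R hd hn, ← hρ]
  congr 2
  ring

lemma scaledDensity_nonneg {d : ℕ} {α ρ : ℝ} (hα : 0 < α) (t : ℝ) :
    0 ≤ scaledDensity d α ρ t := by
  refine Set.indicator_nonneg (fun t ht => ?_) t
  have ht : t ≤ ρ := ht
  have := Real.sinh_nonneg_iff.2 (mul_nonneg hα.le (sub_nonneg.2 ht))
  positivity

lemma sinh_mul_exp (α ρ t : ℝ) : Real.sinh (α * (ρ - t)) * Real.exp (-(α * ρ)) =
    (Real.exp (-(α * t)) - Real.exp (-(2 * α * ρ - α * t))) / 2 := by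
  rw [Real.sinh_eq, div_mul_eq_mul_div, sub_mul, ← Real.exp_add, ← Real.exp_add]
  congr 3 <;> ring_nf

lemma natCast_sub_one {d : ℕ} (hd : 2 ≤ d) : ((d - 1 : ℕ) : ℝ) = (d : ℝ) - 1 := by
  rw [Nat.cast_sub (by omega), Nat.cast_one]

lemma scaledDensity_le {d : ℕ} (hd : 2 ≤ d) {α ρ : ℝ} (hα : 0 < α) (t : ℝ) :
    scaledDensity d α ρ t ≤ Real.exp (-(α * ((d : ℝ) - 1) * t)) := by
  refine Set.indicator_apply_le' (fun ht => ?_) fun _ => (Real.exp_pos _).le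
  have ht : t ≤ ρ := ht
  have h0 := Real.sinh_nonneg_iff.2 (mul_nonneg hα.le (sub_nonneg.2 ht))
  have h1 : Real.sinh (α * (ρ - t)) * Real.exp (-(α * ρ)) ≤ Real.exp (-(α * t)) := by
    rw [sinh_mul_exp]
    have := Real.exp_pos (-(α * t))
    have := Real.exp_pos (-(2 * α * ρ - α * t))
    linarith
  refine (pow_le_pow_left₀ (by positivity) h1 (d - 1)).trans_eq ?_
  rw [← Real.exp_nat_mul, natCast_sub_one hd]
  congr 1
  ring

lemma tendsto_scaledDensity (d : ℕ) {α : ℝ} (hα : 0 < α) (t : ℝ) :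
    Tendsto (fun ρ => scaledDensity d α ρ t) atTop
      (𝓝 ((Real.exp (-(α * t)) / 2) ^ (d - 1))) := by
  have h1 : Tendsto (fun ρ : ℝ => 2 * α * ρ - α * t) atTop atTop :=
    tendsto_atTop_add_const_right _ _ (tendsto_id.const_mul_atTop (by positivity))
  have h2 : Tendsto (fun ρ : ℝ =>
      ((Real.exp (-(α * t)) - Real.exp (-(2 * α * ρ - α * t))) / 2) ^ (d - 1)) atTop
      (𝓝 (((Real.exp (-(α * t)) - 0) / 2) ^ (d - 1))) :=
    (((Real.tendsto_exp_neg_atTop_nhds_zero.comp h1).const_sub _).div_const 2).pow _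
  rw [sub_zero] at h2
  refine h2.congr' ?_
  filter_upwards [eventually_ge_atTop t] with ρ hρ
  rw [scaledDensity, Set.indicator_of_mem (show t ∈ Set.Iic ρ from hρ), sinh_mul_exp]

lemma measurable_scaledDensity (d : ℕ) (α ρ : ℝ) : Measurable (scaledDensity d α ρ) :=
  Measurable.indicator (by fun_prop) measurableSet_Iic

lemma measurable_scaledCap (d : ℕ) (ρ u : ℝ) : Measurable (scaledCap d ρ u) :=
  ((continuous_capProb d).measurable.comp (measurable_threshold ρ u)).const_mul _

lemma integrableOn_exp_neg {c : ℝ} (hc : 0 < c) :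
    IntegrableOn (fun t : ℝ => Real.exp (-(c * t))) (Set.Ioi 0) := by
  simpa only [neg_mul] using exp_neg_integrableOn_Ioi 0 hc

lemma integral_exp_neg_Ioi {c : ℝ} (hc : 0 < c) :
    ∫ t in Set.Ioi (0 : ℝ), Real.exp (-(c * t)) = 1 / c := by
  have := integral_exp_mul_Ioi (neg_lt_zero.2 hc) 0
  simp only [neg_mul, mul_zero, Real.exp_zero] at this
  rw [this]
  field_simp

lemma tendsto_integral_scaledDensity {d : ℕ} (hd : 2 ≤ d) {α : ℝ} (hα : 0 < α) :
    Tendsto (fun ρ => ∫ t in Set.Ioi 0, scaledDensity d α ρ t) atTop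
      (𝓝 (1 / (2 ^ (d - 1) * (α * ((d : ℝ) - 1))))) := by
  have ha := natCast_sub_one_pos hd
  have hlim : ∫ t in Set.Ioi (0 : ℝ), (Real.exp (-(α * t)) / 2) ^ (d - 1) =
      1 / (2 ^ (d - 1) * (α * ((d : ℝ) - 1))) := by
    have h : ∀ t, (Real.exp (-(α * t)) / 2) ^ (d - 1) =
        1 / 2 ^ (d - 1) * Real.exp (-(α * ((d : ℝ) - 1) * t)) := by
      intro t
      rw [div_pow, ← Real.exp_nat_mul, natCast_sub_one hd, div_eq_mul_one_div, mul_comm]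
      congr 2
      ring
    simp only [h]
    rw [integral_const_mul, integral_exp_neg_Ioi (by positivity), one_div_mul_one_div]
  rw [← hlim]
  refine tendsto_integral_filter_of_dominated_convergence
    (fun t => Real.exp (-(α * ((d : ℝ) - 1) * t)))
    (Eventually.of_forall fun ρ => (measurable_scaledDensity d α ρ).aestronglyMeasurable)
    (Eventually.of_forall fun ρ => Eventually.of_forall fun t => ?_)
    (integrableOn_exp_neg (by positivity))
    (Eventually.of_forall fun t => tendsto_scaledDensity d hα t)
  rw [Real.norm_eq_abs, abs_of_nonneg (scaledDensity_nonneg hα t)]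
  exact scaledDensity_le hd hα t

/-- The constant in the bound for `scaledCap`. -/
noncomputable def capConst (d : ℕ) : ℝ :=
  Real.exp (((d : ℝ) - 1) / 2) + (4 * Real.pi) ^ (d - 1) / kappa d

lemma capConst_pos (d : ℕ) : 0 < capConst d := by
  have := kappa_pos d
  have := Real.pi_pos
  unfold capConst
  positivity

lemma scaledCap_nonneg (d : ℕ) (ρ u t : ℝ) : 0 ≤ scaledCap d ρ u t :=
  mul_nonneg (Real.exp_pos _).le (capProb_nonneg _ _)

/-- A bound for the adjacency probability, uniform in all parameters. If one of the two points
is at distance less than `1` from the origin, the trivial bound `1` suffices. -/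
lemma scaledCap_le {d : ℕ} (hd : 2 ≤ d) {ρ u t : ℝ} (hu0 : 0 < u) (hu : u < ρ) (ht0 : 0 < t) :
    scaledCap d ρ u t ≤ capConst d * Real.exp (((d : ℝ) - 1) * t / 2) := by
  have ha := natCast_sub_one_pos hd
  have hk := kappa_pos d
  have hpi := Real.pi_pos
  have hC : 0 ≤ (4 * Real.pi) ^ (d - 1) / kappa d := by positivity
  rw [capConst, add_mul]
  by_cases h : 1 ≤ ρ - t ∧ 1 ≤ ρ - u
  · refine le_trans ?_ (le_add_of_nonneg_left (by positivity))
    have h1 := one_sub_threshold_le h.1 h.2 (by linarith)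
    have h2 : √(1 - threshold ρ t u) ≤ 4 * Real.exp (-(ρ - t - u) / 2) := by
      refine (Real.sqrt_le_sqrt h1).trans_eq ?_
      rw [Real.sqrt_mul (by norm_num), show (16 : ℝ) = 4 ^ 2 by norm_num,
        Real.sqrt_sq (by norm_num), ← Real.exp_half]
    have h3 := capProb_le hd (threshold_le_one ht0.le (by linarith [h.1]) hu0.le hu)
    calc scaledCap d ρ u t ≤ Real.exp (((d : ℝ) - 1) * (ρ - u) / 2) *
          ((Real.pi * (4 * Real.exp (-(ρ - t - u) / 2))) ^ (d - 1) / kappa d) := by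
          unfold scaledCap
          gcongr
          exact h3.trans (by gcongr)
      _ = (4 * Real.pi) ^ (d - 1) / kappa d * (Real.exp (((d : ℝ) - 1) * (ρ - u) / 2) *
            Real.exp (((d : ℝ) - 1) * (-(ρ - t - u) / 2))) := by
          rw [← mul_assoc Real.pi, mul_pow, ← Real.exp_nat_mul, natCast_sub_one hd]
          ring
      _ = _ := by
          rw [← Real.exp_add]
          congr 2
          ring
  · refine le_trans ?_ (le_add_of_nonneg_right (by positivity))
    have h1 : ρ - t - u ≤ 1 := by
      rw [not_and_or, not_le, not_le] at h
      rcases h with h | h <;> linarith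
    calc scaledCap d ρ u t ≤ Real.exp (((d : ℝ) - 1) * (ρ - u) / 2) * 1 := by
          unfold scaledCap
          gcongr
          exact capProb_le_one _ _
      _ ≤ _ := by
          rw [mul_one, ← Real.exp_add, Real.exp_le_exp]
          nlinarith

lemma scaledDensity_mul_scaledCap_le {d : ℕ} (hd : 2 ≤ d) {α ρ u t : ℝ} (hα : 0 < α)
    (hu0 : 0 < u) (hu : u < ρ) (ht0 : 0 < t) :
    scaledDensity d α ρ t * scaledCap d ρ u t ≤
      capConst d * Real.exp (-(((d : ℝ) - 1) * (α - 1 / 2) * t)) := by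
  have hC := capConst_pos d
  by_cases ht : t ≤ ρ
  · calc scaledDensity d α ρ t * scaledCap d ρ u t ≤ Real.exp (-(α * ((d : ℝ) - 1) * t)) *
          (capConst d * Real.exp (((d : ℝ) - 1) * t / 2)) := by
          gcongr
          · exact scaledCap_nonneg d ρ u t
          · exact scaledDensity_le hd hα t
          · exact scaledCap_le hd hu0 hu ht0
      _ = _ := by
          rw [mul_left_comm, ← Real.exp_add]
          congr 2
          ring
  · rw [scaledDensity, Set.indicator_of_notMem (show t ∉ Set.Iic ρ from ht), zero_mul]
    positivity

/-- The scaled degree is bounded, uniformly over all depths. -/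
lemma exists_scaledDegree_le {d : ℕ} (hd : 2 ≤ d) {α : ℝ} (hα : 1 / 2 < α) :
    ∃ C : ℝ, 0 < C ∧ ∀ᶠ ρ in atTop, ∀ u ∈ Set.Ioo 0 ρ, scaledDegree d α ρ u ≤ C := by
  have hα0 : 0 < α := by linarith
  have ha := natCast_sub_one_pos hd
  have hc : 0 < ((d : ℝ) - 1) * (α - 1 / 2) := mul_pos ha (by linarith)
  have hC := capConst_pos d
  set L := 1 / (2 ^ (d - 1) * (α * ((d : ℝ) - 1))) with hL
  have hL0 : 0 < L := by positivity
  refine ⟨capConst d * (1 / (((d : ℝ) - 1) * (α - 1 / 2))) / (L / 2), by positivity, ?_⟩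
  have hev := (tendsto_integral_scaledDensity hd hα0).eventually
    (eventually_gt_nhds (by linarith : L / 2 < L))
  filter_upwards [hev] with ρ hρ u hu
  have hnum : ∫ t in Set.Ioi 0, scaledDensity d α ρ t * scaledCap d ρ u t ≤
      capConst d * (1 / (((d : ℝ) - 1) * (α - 1 / 2))) := by
    rw [← integral_exp_neg_Ioi hc, ← integral_const_mul]
    refine integral_mono_of_nonneg (Eventually.of_forall fun t =>
      mul_nonneg (scaledDensity_nonneg hα0 t) (scaledCap_nonneg d ρ u t))
      ((integrableOn_exp_neg hc).const_mul _) ?_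
    refine (ae_restrict_iff' measurableSet_Ioi).2 (Eventually.of_forall fun t ht => ?_)
    exact scaledDensity_mul_scaledCap_le hd hα0 hu.1 hu.2 ht
  unfold scaledDegree
  gcongr

/-- The filter of pairs `(ρ, u)` with `ρ → ∞` and `0 < u < γ ρ`; a limit along it is a limit as
`ρ → ∞`, uniform in `u ∈ (0, γ ρ)`. -/
def bulk (γ : ℝ) : Filter (ℝ × ℝ) :=
  (atTop ×ˢ ⊤) ⊓ 𝓟 {p | p.2 ∈ Set.Ioo 0 (γ * p.1)}

instance (γ : ℝ) : (bulk γ).IsCountablyGenerated := by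
  unfold bulk; infer_instance

lemma tendsto_fst_bulk (γ : ℝ) : Tendsto Prod.fst (bulk γ) atTop :=
  tendsto_fst.mono_left inf_le_left

lemma eventually_bulk (γ : ℝ) : ∀ᶠ p in bulk γ, p.2 ∈ Set.Ioo 0 (γ * p.1) :=
  eventually_inf_principal.2 (Eventually.of_forall fun _ hp => hp)

lemma tendsto_sub_bulk {γ : ℝ} (hγ : γ < 1) :
    Tendsto (fun p : ℝ × ℝ => p.1 - p.2) (bulk γ) atTop := by
  have h1 : Tendsto (fun p : ℝ × ℝ => (1 - γ) * p.1) (bulk γ) atTop :=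
    (tendsto_fst_bulk γ).const_mul_atTop (by linarith)
  refine tendsto_atTop_mono' _ ?_ h1
  filter_upwards [eventually_bulk γ] with p hp
  linarith [hp.2]

/-- `1 - threshold ρ t u` is asymptotic to `2 e^{-(ρ - t - u)}`, uniformly in the bulk. -/
lemma tendsto_threshold {γ : ℝ} (hγ : γ < 1) (t : ℝ) :
    Tendsto (fun p : ℝ × ℝ => (1 - threshold p.1 t p.2) * Real.exp (p.1 - t - p.2)) (bulk γ)
      (𝓝 2) := by
  have hfst := tendsto_fst_bulk γ
  have hsub := tendsto_sub_bulk hγ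
  have hexp : ∀ f : ℝ × ℝ → ℝ, Tendsto f (bulk γ) atTop →
      Tendsto (fun p => Real.exp (-(f p))) (bulk γ) (𝓝 0) := fun f hf =>
    Real.tendsto_exp_neg_atTop_nhds_zero.comp hf
  have hfst' : Tendsto (fun p : ℝ × ℝ => p.1 - t) (bulk γ) atTop :=
    tendsto_atTop_add_const_right _ (-t) hfst
  have e1 := hexp _ (hfst.const_mul_atTop two_pos)
  have h2 : Tendsto (fun p : ℝ × ℝ => p.1 - t + p.2) (bulk γ) atTop := by
    refine tendsto_atTop_mono' _ ?_ hfst'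
    filter_upwards [eventually_bulk γ] with p hp
    linarith [hp.1]
  have e2 := hexp _ h2
  have e3 := hexp _ (tendsto_atTop_add_const_right _ t hsub)
  have e4 := hexp _ (hfst'.const_mul_atTop two_pos)
  have e5 := hexp _ (hsub.const_mul_atTop two_pos)
  have hlim := ((((e1.const_add 1).sub e2).sub e3).const_mul 2).div
    ((e4.const_sub 1).mul (e5.const_sub 1)) (by norm_num)
  simp only [add_zero, sub_zero, mul_one, div_one] at hlim
  refine hlim.congr' ?_
  filter_upwards [eventually_bulk γ, hfst.eventually_gt_atTop t, hsub.eventually_gt_atTop 0]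
    with p hp h1 h2
  exact (one_sub_threshold_mul_exp h1 (by linarith)).symm

lemma tendsto_scaledCap {d : ℕ} (hd : 2 ≤ d) {γ : ℝ} (hγ : γ < 1) (t : ℝ) :
    Tendsto (fun p : ℝ × ℝ => scaledCap d p.1 p.2 t) (bulk γ)
      (𝓝 (Real.exp (((d : ℝ) - 1) * t / 2) * (2 ^ (d - 1) / (((d : ℝ) - 1) * kappa d)))) := by
  have hthr := tendsto_threshold hγ t
  have hsub := tendsto_sub_bulk hγ
  have hexp : Tendsto (fun p : ℝ × ℝ => Real.exp (-(p.1 - t - p.2))) (bulk γ) (𝓝 0) := by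
    refine Real.tendsto_exp_neg_atTop_nhds_zero.comp ?_
    refine (tendsto_atTop_add_const_right _ (-t) hsub).congr fun p => ?_
    ring
  have hev : ∀ᶠ p in bulk γ, t < p.1 ∧ 0 < p.2 ∧ p.2 < p.1 := by
    filter_upwards [eventually_bulk γ, (tendsto_fst_bulk γ).eventually_gt_atTop t,
      hsub.eventually_gt_atTop 0] with p hp h1 h2
    exact ⟨h1, hp.1, by linarith⟩
  have hlt : ∀ᶠ p in bulk γ, threshold p.1 t p.2 < 1 := by
    filter_upwards [hthr.eventually (eventually_gt_nhds two_pos)] with p hp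
    have := (pos_iff_pos_of_mul_pos hp).2 (Real.exp_pos _)
    linarith
  have hone : Tendsto (fun p : ℝ × ℝ => threshold p.1 t p.2) (bulk γ) (𝓝[<] 1) := by
    refine tendsto_nhdsWithin_iff.2 ⟨?_, hlt⟩
    have h1 := (hthr.mul hexp).const_sub 1
    rw [mul_zero, sub_zero] at h1
    refine h1.congr fun p => ?_
    rw [mul_assoc, ← Real.exp_add, add_neg_cancel, Real.exp_zero]
    ring
  have hcap := (tendsto_capProb hd).comp hone
  have hsqrt : Tendsto (fun p : ℝ × ℝ =>
      √(1 - threshold p.1 t p.2) * Real.exp ((p.1 - t - p.2) / 2)) (bulk γ) (𝓝 √2) := by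
    refine ((Real.continuous_sqrt.tendsto 2).comp hthr).congr' ?_
    filter_upwards [hlt] with p hp
    simp only [Function.comp]
    rw [Real.sqrt_mul (by linarith), ← Real.exp_half]
  have hlim := (hcap.mul (hsqrt.pow (d - 1))).const_mul (Real.exp (((d : ℝ) - 1) * t / 2))
  have h2 : √2 ^ (d - 1) * √2 ^ (d - 1) = 2 ^ (d - 1) := by
    rw [← mul_pow, Real.mul_self_sqrt zero_le_two]
  rw [div_mul_eq_mul_div, h2] at hlim
  refine hlim.congr' ?_
  filter_upwards [hlt] with p hp
  have hs : 0 < √(1 - threshold p.1 t p.2) := Real.sqrt_pos.2 (by linarith)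
  simp only [Function.comp]
  rw [mul_pow, ← mul_assoc (_ / _), div_mul_cancel₀ _ (by positivity), ← Real.exp_nat_mul,
    natCast_sub_one hd, mul_left_comm, ← Real.exp_add, mul_comm, scaledCap]
  congr 2
  ring

/-- The scaled degree converges to `B_α`, uniformly over depths `u ∈ (0, γ ρ)`. -/
theorem tendsto_scaledDegree {d : ℕ} (hd : 2 ≤ d) {α : ℝ} (hα : 1 / 2 < α) {γ : ℝ} (hγ : γ < 1) :
    Tendsto (fun p : ℝ × ℝ => scaledDegree d α p.1 p.2) (bulk γ) (𝓝 (B d α)) := by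
  have hα0 : 0 < α := by linarith
  have ha := natCast_sub_one_pos hd
  have hk := kappa_pos d
  have hα2 : 0 < α - 1 / 2 := by linarith
  have hc : 0 < ((d : ℝ) - 1) * (α - 1 / 2) := mul_pos ha hα2
  have hden := (tendsto_integral_scaledDensity hd hα0).comp (tendsto_fst_bulk γ)
  set M := 1 / (((d : ℝ) - 1) * kappa d) with hM
  have hlim : ∫ t in Set.Ioi (0 : ℝ), (Real.exp (-(α * t)) / 2) ^ (d - 1) *
      (Real.exp (((d : ℝ) - 1) * t / 2) * (2 ^ (d - 1) / (((d : ℝ) - 1) * kappa d))) =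
      M * (1 / (((d : ℝ) - 1) * (α - 1 / 2))) := by
    rw [← integral_exp_neg_Ioi hc, ← integral_const_mul]
    refine integral_congr_ae (Eventually.of_forall fun t => ?_)
    simp only
    have h1 : Real.exp (-(((d : ℝ) - 1) * (α - 1 / 2) * t)) =
        Real.exp (-(α * t)) ^ (d - 1) * Real.exp (((d : ℝ) - 1) * t / 2) := by
      rw [← Real.exp_nat_mul, natCast_sub_one hd, ← Real.exp_add]
      congr 1
      ring
    rw [h1, div_pow, hM]
    field_simp
  have hnum : Tendsto (fun p : ℝ × ℝ =>
      ∫ t in Set.Ioi 0, scaledDensity d α p.1 t * scaledCap d p.1 p.2 t) (bulk γ)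
      (𝓝 (M * (1 / (((d : ℝ) - 1) * (α - 1 / 2))))) := by
    rw [← hlim]
    refine tendsto_integral_filter_of_dominated_convergence
      (fun t => capConst d * Real.exp (-(((d : ℝ) - 1) * (α - 1 / 2) * t)))
      (Eventually.of_forall fun p => ((measurable_scaledDensity d α p.1).mul
        (measurable_scaledCap d p.1 p.2)).aestronglyMeasurable) ?_
      ((integrableOn_exp_neg hc).const_mul _) ?_
    · filter_upwards [eventually_bulk γ, (tendsto_sub_bulk hγ).eventually_gt_atTop 0] with p hp h1
      refine (ae_restrict_iff' measurableSet_Ioi).2 (Eventually.of_forall fun t ht => ?_)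
      rw [Real.norm_eq_abs, abs_of_nonneg (mul_nonneg (scaledDensity_nonneg hα0 t)
        (scaledCap_nonneg d p.1 p.2 t))]
      exact scaledDensity_mul_scaledCap_le hd hα0 hp.1 (by linarith) ht
    · exact Eventually.of_forall fun t =>
        ((tendsto_scaledDensity d hα0 t).comp (tendsto_fst_bulk γ)).mul
          (tendsto_scaledCap hd hγ t)
  have h := hnum.div hden (by positivity)
  have hB : M * (1 / (((d : ℝ) - 1) * (α - 1 / 2))) / (1 / (2 ^ (d - 1) * (α * ((d : ℝ) - 1)))) =
      B d α := by
    have h2 : (2 : ℝ) ^ d = 2 * 2 ^ (d - 1) := by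
      rw [← pow_succ']; congr 1; omega
    have h3 : 2 * α - 1 = 2 * (α - 1 / 2) := by ring
    rw [hM, B, h2, h3]
    field_simp
  rw [hB] at h
  exact h

/-! ### The star counts -/

/-- The expected star count is the `(k-1)`-st power of the expected degree; in particular it does
not depend on `θ`. -/
lemma mu_eq {d k n : ℕ} {α u : ℝ} (hd : 2 ≤ d) (hk : 2 ≤ k) (hn : 2 ≤ n) (hα : 0 < α)
    (hu : u ∈ Set.Ioo 0 (R d n)) (θ : Fin (d - 1) → ℝ) :
    mu d k n α u θ = scaledDegree d α (R d n) u ^ (k - 1) *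
      Real.exp (1 / 2 * ((d : ℝ) - 1) * ((k : ℝ) - 1) * u) := by
  rw [(integrable_D_and_mu_eq hd hn hα hu θ).2, mul_connProb hd hn hα, mul_pow,
    ← Real.exp_nat_mul, mul_comm, natCast_sub_one hk]
  congr 2
  ring

lemma tendsto_R {d : ℕ} (hd : 2 ≤ d) : Tendsto (R d) atTop atTop :=
  (Real.tendsto_log_atTop.comp tendsto_natCast_atTop_atTop).const_mul_atTop
    (div_pos two_pos (natCast_sub_one_pos hd))

lemma scaledDegree_nonneg {d : ℕ} {α : ℝ} (hα : 0 < α) (ρ u : ℝ) : 0 ≤ scaledDegree d α ρ u :=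
  div_nonneg (integral_nonneg fun t => mul_nonneg (scaledDensity_nonneg hα t)
    (scaledCap_nonneg d ρ u t)) (integral_nonneg fun t => scaledDensity_nonneg hα t)

/-- A uniformly vanishing error is bounded by a null sequence. -/
lemma exists_tendsto_zero_bound {f : ℕ → ℝ → ℝ} {S : ℕ → Set ℝ}
    (h : ∀ δ > 0, ∀ᶠ n in atTop, ∀ u ∈ S n, |f n u| < δ) :
    ∃ ε : ℕ → ℝ, Tendsto ε atTop (𝓝 0) ∧ (∀ n, 0 ≤ ε n) ∧
      ∀ᶠ n in atTop, ∀ u ∈ S n, |f n u| ≤ ε n := by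
  have h0 : ∀ n, 0 ≤ ⨆ u : S n, |f n u| := fun n => Real.iSup_nonneg fun u => abs_nonneg _
  refine ⟨fun n => ⨆ u : S n, |f n u|, ?_, h0, ?_⟩
  · rw [Metric.tendsto_atTop']
    intro δ hδ
    obtain ⟨N, hN⟩ := eventually_atTop.1 (h (δ / 2) (by linarith))
    refine ⟨N, fun n hn => ?_⟩
    rw [Real.dist_eq, sub_zero, abs_of_nonneg (h0 n)]
    have : ⨆ u : S n, |f n u| ≤ δ / 2 :=
      Real.iSup_le (fun u => (hN n hn.le u u.2).le) (by linarith)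
    linarith
  · filter_upwards [h 1 one_pos] with n hn u hu
    exact le_ciSup (f := fun u : S n => |f n u|)
      ⟨1, by rintro _ ⟨v, rfl⟩; exact (hn v v.2).le⟩ ⟨u, hu⟩

lemma B_pos {d : ℕ} (hd : 2 ≤ d) {α : ℝ} (hα : 1 / 2 < α) : 0 < B d α := by
  have := natCast_sub_one_pos hd
  have := kappa_pos d
  have : 0 < 2 * α - 1 := by linarith
  have : 0 < α := by linarith
  unfold B
  positivity

/-- The `(k-1)`-st power of the scaled degree equals `(1 + o(1)) B_{k,α}`, uniformly over the
depths `u ∈ (0, γ R_n)`. -/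
lemma exists_error_bound {d : ℕ} (k : ℕ) (hd : 2 ≤ d) {α : ℝ} (hα : 1 / 2 < α) {γ : ℝ}
    (hγ : γ < 1) :
    ∃ ε : ℕ → ℝ, Tendsto ε atTop (𝓝 0) ∧ (∀ n, 0 ≤ ε n) ∧
      ∀ᶠ n : ℕ in atTop, ∀ u ∈ Set.Ioo 0 (γ * R d n),
        |scaledDegree d α (R d n) u ^ (k - 1) / Bk d k α - 1| ≤ ε n := by
  refine exists_tendsto_zero_bound fun δ hδ => ?_
  have hB : 0 < Bk d k α := pow_pos (B_pos hd hα) _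
  have h1 := (((tendsto_scaledDegree hd hα hγ).pow (k - 1)).div_const (Bk d k α)).sub_const 1
  rw [← Bk, div_self hB.ne', sub_self] at h1
  have h2 : ∀ᶠ p : ℝ × ℝ in bulk γ,
      |scaledDegree d α p.1 p.2 ^ (k - 1) / Bk d k α - 1| < δ := by
    have h3 := h1.abs
    rw [abs_zero] at h3
    exact h3.eventually (eventually_lt_nhds hδ)
  rw [bulk, eventually_inf_principal, prod_top, eventually_comap] at h2
  filter_upwards [(tendsto_R hd).eventually h2] with n hn u hu
  exact hn (R d n, u) rfl hu

lemma tendsto_omega {d : ℕ} (hd : 2 ≤ d) : Tendsto (omega d) atTop atTop :=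
  Real.tendsto_log_atTop.comp (Real.tendsto_log_atTop.comp (tendsto_R hd))

lemma mu_le_pow {d k n : ℕ} {α u : ℝ} (hd : 2 ≤ d) (hn : 2 ≤ n) (hα : 0 < α)
    (hu : u ∈ Set.Ioo 0 (R d n)) (θ : Fin (d - 1) → ℝ) : mu d k n α u θ ≤ (n : ℝ) ^ (k - 1) := by
  have := isProbabilityMeasure_vertexLaw hd hn hα
  have h0 := connProb_nonneg (u := u) hd hn hα
  have h1 : connProb d n α u ≤ 1 := by
    rw [← ENNReal.ofReal_le_one, ← vertexLaw_hypBall hd hn hα hu θ]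
    exact prob_le_one
  rw [(integrable_D_and_mu_eq hd hn hα hu θ).2]
  exact pow_le_pow_left₀ (by positivity) (mul_le_of_le_one_right (Nat.cast_nonneg n) h1) _

/-- For `n = 1` the ball is degenerate: `R_1 = 0`. -/
lemma two_le_of_mem {d n : ℕ} (hn : 1 ≤ n) {u : ℝ} (hu : u ∈ Set.Ioo 0 (R d n)) : 2 ≤ n := by
  rcases Nat.lt_or_ge n 2 with h | h
  · obtain rfl : n = 1 := by omega
    have := hu.1.trans hu.2
    simp [R] at this
  · exact h

end HypStar

theorem proposition2p2 (d k : ℕ) (hd : 2 ≤ d) (hk : 2 ≤ k) (α : ℝ) (hα : 1 / 2 < α)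
    (hα' : α < (k : ℝ) - 1) :
    -- the expectations are finite
    (∀ n : ℕ, 1 ≤ n → ∀ u ∈ Set.Ioo 0 (HypStar.R d n), ∀ θ ∈ HypStar.angles d,
      Integrable (HypStar.D d k n u θ) (HypStar.vertexSample d n α)) ∧
    (∀ γ : ℝ, 1 / (2 * α) < γ → γ < 1 →
      -- (i)
      (∃ ε : ℕ → ℝ, Tendsto ε atTop (𝓝 0) ∧ ∀ᶠ n : ℕ in atTop,
        ∀ u ∈ Set.Ioo 0 (γ * HypStar.R d n), ∀ θ ∈ HypStar.angles d,
          HypStar.mu d k n α u θ ≤ (1 + ε n) * HypStar.Bk d k α *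
            (1 + ∑ l ∈ Finset.range (k - 1), ((k - 1).choose l : ℝ) *
              (Real.exp (1 / 2 * ((d : ℝ) - 1) * (1 - 2 * α) * u) + HypStar.s d α γ n)
                ^ (k - 1 - l)) *
            Real.exp (1 / 2 * ((d : ℝ) - 1) * ((k : ℝ) - 1) * u)) ∧
      -- (ii)
      (∃ ε : ℕ → ℝ, Tendsto ε atTop (𝓝 0) ∧ ∀ᶠ n : ℕ in atTop,
        ∀ u ∈ Set.Ioo 0 (γ * HypStar.R d n), ∀ θ ∈ HypStar.angles d,
          (1 + ε n) * HypStar.Bk d k α *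
            (1 - Real.exp (1 / 2 * ((d : ℝ) - 1) * (1 - 2 * α) * u)) ^ (k - 1) *
            Real.exp (1 / 2 * ((d : ℝ) - 1) * ((k : ℝ) - 1) * u) ≤ HypStar.mu d k n α u θ)) ∧
    -- (iii)
    (∃ C : ℝ, 0 < C ∧ ∀ n : ℕ, 1 ≤ n → ∀ u ∈ Set.Ioo 0 (HypStar.R d n),
      ∀ θ ∈ HypStar.angles d,
        HypStar.mu d k n α u θ ≤
          C * Real.exp (α * ((d : ℝ) - 1) * ((k : ℝ) - 1) * HypStar.omega d n) *
            Real.exp (1 / 2 * ((d : ℝ) - 1) * ((k : ℝ) - 1) * u)) := by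
  have hα0 : 0 < α := by linarith
  have ha := HypStar.natCast_sub_one_pos hd
  have hk1 : (0 : ℝ) < (k : ℝ) - 1 := HypStar.natCast_sub_one_pos hk
  have hBk : 0 < HypStar.Bk d k α := pow_pos (HypStar.B_pos hd hα) _
  refine ⟨fun n hn u hu θ _ => (HypStar.integrable_D_and_mu_eq hd
    (HypStar.two_le_of_mem hn hu) hα0 hu θ).1, fun γ _ hγ1 => ?_, ?_⟩
  · obtain ⟨ε, hε, hε0, hbound⟩ := HypStar.exists_error_bound k hd hα hγ1
    have hmem : ∀ n, 2 ≤ n → ∀ u ∈ Set.Ioo 0 (γ * HypStar.R d n),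
        u ∈ Set.Ioo 0 (HypStar.R d n) := by
      intro n hn u hu
      have := HypStar.R_pos hd hn
      exact ⟨hu.1, hu.2.trans_le (by nlinarith)⟩
    refine ⟨⟨ε, hε, ?_⟩, ⟨fun n => -ε n, by simpa using hε.neg, ?_⟩⟩
    · filter_upwards [hbound, eventually_ge_atTop 2] with n hn hn2 u hu θ _
      rw [HypStar.mu_eq hd hk hn2 hα0 (hmem n hn2 u hu)]
      gcongr
      have h1 := (abs_le.1 (hn u hu)).2
      rw [sub_le_iff_le_add', div_le_iff₀ hBk] at h1
      refine h1.trans (le_mul_of_one_le_right ?_ ?_)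
      · have := hε0 n
        positivity
      · have hs : 0 ≤ HypStar.s d α γ n := by
          have := HypStar.B_pos hd hα
          unfold HypStar.s
          positivity
        exact le_add_of_nonneg_right (Finset.sum_nonneg fun l _ => by positivity)
    · filter_upwards [hbound, eventually_ge_atTop 2, hε.eventually (eventually_lt_nhds one_pos)]
        with n hn hn2 hn1 u hu θ _
      rw [HypStar.mu_eq hd hk hn2 hα0 (hmem n hn2 u hu)]
      gcongr
      have h1 := (abs_le.1 (hn u hu)).1
      have h2 : 1 + -ε n ≤
          HypStar.scaledDegree d α (HypStar.R d n) u ^ (k - 1) / HypStar.Bk d k α := by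
        linarith
      rw [le_div_iff₀ hBk] at h2
      refine le_trans (mul_le_of_le_one_right ?_ ?_) h2
      · exact mul_nonneg (by linarith) hBk.le
      · have h3 : Real.exp (1 / 2 * ((d : ℝ) - 1) * (1 - 2 * α) * u) ≤ 1 := by
          refine Real.exp_le_one_iff.2 (mul_nonpos_of_nonpos_of_nonneg ?_ hu.1.le)
          exact mul_nonpos_of_nonneg_of_nonpos (by positivity) (by linarith)
        have h4 := Real.exp_pos (1 / 2 * ((d : ℝ) - 1) * (1 - 2 * α) * u)
        exact pow_le_one₀ (by linarith) (by linarith)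
  · obtain ⟨C, hC, hCbound⟩ := HypStar.exists_scaledDegree_le hd hα
    obtain ⟨N, hN⟩ := eventually_atTop.1 (((HypStar.tendsto_R hd).eventually hCbound).and
      ((HypStar.tendsto_omega hd).eventually_ge_atTop 0))
    set w : ℕ → ℝ := fun n =>
      Real.exp (α * ((d : ℝ) - 1) * ((k : ℝ) - 1) * HypStar.omega d n) with hw
    -- the finitely many `n < N` are covered by the trivial bound `n ^ (k - 1)`
    set C' : ℝ := ∑ n ∈ Finset.range N, (n : ℝ) ^ (k - 1) / w n with hC'
    have hC'0 : 0 ≤ C' := Finset.sum_nonneg fun n _ => by positivity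
    refine ⟨C ^ (k - 1) + C', by positivity, fun n hn u hu θ _ => ?_⟩
    have hn2 := HypStar.two_le_of_mem hn hu
    change _ ≤ (C ^ (k - 1) + C') * w n * _
    have hw0 : 0 < w n := Real.exp_pos _
    have hu0 := hu.1
    rcases lt_or_ge n N with hnN | hnN
    · have h1 : (n : ℝ) ^ (k - 1) ≤ C' * w n := by
        rw [← div_le_iff₀ hw0]
        exact Finset.single_le_sum (f := fun n : ℕ => (n : ℝ) ^ (k - 1) / w n)
          (fun i _ => by positivity) (Finset.mem_range.2 hnN)
      have h2 : 1 ≤ Real.exp (1 / 2 * ((d : ℝ) - 1) * ((k : ℝ) - 1) * u) :=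
        Real.one_le_exp (by positivity)
      calc HypStar.mu d k n α u θ ≤ (n : ℝ) ^ (k - 1) := HypStar.mu_le_pow hd hn2 hα0 hu θ
        _ ≤ (C ^ (k - 1) + C') * w n := h1.trans (by gcongr; linarith [pow_pos hC (k - 1)])
        _ ≤ _ := le_mul_of_one_le_right (by positivity) h2
    · have h1 := (hN n hnN).1 u hu
      have h2 : 1 ≤ w n := by
        have := (hN n hnN).2
        exact Real.one_le_exp (by positivity)
      rw [HypStar.mu_eq hd hk hn2 hα0 hu]
      gcongr
      calc HypStar.scaledDegree d α (HypStar.R d n) u ^ (k - 1) ≤ C ^ (k - 1) :=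
            pow_le_pow_left₀ (HypStar.scaledDegree_nonneg hα0 _ _) h1 _
        _ ≤ C ^ (k - 1) + C' := by linarith
        _ ≤ _ := le_mul_of_one_le_right (by positivity) h2
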